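/- **Setting.** Let $\mathbb Z=(T,Y,\mathbf X)\in\{0,1\}\times\mathbb R\times\mathbb R^p$ with $E|Y|<\infty$ and $T\perp Y\mid\mathbf X$; let $\mathcal X$ be the support of $\mathbf X$, $m(\mathbf x)=E(Y\mid\mathbf X=\mathbf x)$ and $\pi(\mathbf x)=P(T=1\mid\mathbf X=\mathbf x)$ with $\pi(\mathbf x)\ge\delta_\pi$ for all $\mathbf x\in\mathcal X$, where $\delta_\pi\in(0,1]$. Let $\mathbf h:\mathbb R^p\to\mathbb R^d$, $d\ge 2$, be measurable with $\max_{1\le j\le d}\|\mathbf h_{[j]}(\mathbf X)\|_{\psi_2}\le\sigma_{\mathbf h}$, where $\|V\|_{\psi_2}=\inf\{a>0: E[\exp(V^2/a^2)-1]\le 1\}$, and put $\|\mu^{(2)}_{\mathbf h}\|_\infty=\max_{1\le j\le d}E\{\mathbf h_{[j]}^2(\mathbf X)\}$. Let $n=2\bar n$ with $\bar n\ge1$ be even, and let $\mathbf Z_i=(T_i,T_iY_i,\mathbf X_i)$, $i\le n$, be i.i.d. copies of $(T,TY,\mathbf X)$, randomly split, independently of the data, into two folds of size $\bar n$ with index sets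 $\mathcal I_1,\mathcal I_2$. An estimation procedure $\widehat m$ applied to fold $k$ gives $\widehat m^{(k)}$; put $\widetilde m(\mathbf X_i)=\widehat m^{(2)}(\mathbf X_i)$ for $i\in\mathcal I_1$ and $\widetilde m(\mathbf X_i)=\widehat m^{(1)}(\mathbf X_i)$ for $i\in\mathcal I_2$. Assume that for $\widehat m$ computed from $\bar n$ i.i.d. observations, for all $\mathbf x\in\mathcal X$ and $t\ge0$, $$P\{|\widehat m(\mathbf x)-m(\mathbf x)|>t\,v_{\bar n,m}\}\le C\exp(-t^2)+q_{\bar n,m},$$ with $C>0$, $v_{\bar n,m}\ge 0$ and $q_{\bar n,m}\in[0,1]$. Here $p$, $d$, the law of $\mathbb Z$, $\mathbf h$ and $\widehat m$ may vary with $n$, while $\delta_\pi,\sigma_{\mathbf h},C$ do not. Let $$\mathbf T_{m,n}=\frac1n\sum_{i=1}^n\Big\{\frac{T_i}{\pi(\mathbf X_i)}-1\Big\}\{\widetilde m(\mathbf X_i)-m(\mathbf X_i)\}\mathbf h(\mathbf X_i)\in\mathbb R^d .$$ **Theorem (Control of $\|\mathbf T_{m,n}\|_\infty$).** (i) For any constants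 $c,c_1,c_2>1$ with $c_2\sqrt{(\log d)/\bar n}<1$, with probability at least $$1-4d^{-(c^2-1)}-8d^{-(c_2^2-1)}-4C(\bar n d)^{-(c_1^2-1)}-4q_{\bar n,m}(\bar n d),$$ $$\|\mathbf T_{m,n}\|_\infty\le B_n:=c\sqrt{\frac{\log d}{n}}\,\{v_{\bar n,m}\sqrt{\log(nd)}\}\,C_1^*\Big(\|\mu^{(2)}_{\mathbf h}\|_\infty+C_2^*\sqrt{\frac{\log d}{n}}\Big)^{1/2},$$ where $C_1^*=4c_1\bar\delta_\pi$, $C_2^*=\sqrt2\,c_2(\sqrt2\,\sigma_m+K_m)$, $\sigma_m=2\sqrt2\,\sigma_{\mathbf h}^2$, $K_m=2\sigma_{\mathbf h}^2$, and $\bar\delta_\pi=2\widetilde\delta_\pi/\delta_\pi$ with $\widetilde\delta_\pi=1/2$ if $\delta_\pi=1/2$, $\widetilde\delta_\pi=0$ if $\delta_\pi=1$, and $\widetilde\delta_\pi=[(\delta_\pi-1/2)/\log\{\delta_\pi/(1-\delta_\pi)\}]^{1/2}$ otherwise; moreover $\bar\delta_\pi\le\delta_\pi^{-1}$. (ii)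 Suppose in addition that $v_{\bar n,m}\sqrt{\log(nd)}=o(1)$ and $q_{\bar n,m}=o(n^{-1}d^{-1})$ as $n\to\infty$, and let $c,c_1,c_2>1$ be constants with $c_2\sqrt{(\log d)/\bar n}<1$ for all large $n$. Then $B_n=O\big(\sqrt{(\log d)/n}\,\{v_{\bar n,m}\sqrt{\log(nd)}\}\big)$, hence $B_n=o(\sqrt{(\log d)/n})$, and $\|\mathbf T_{m,n}\|_\infty=o_P(\sqrt{(\log d)/n})$. -/

import Mathlib

open MeasureTheory ProbabilityTheory Filter Topology Asymptotics
open scoped ENNReal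

noncomputable section

namespace CrossFit

/-! ### The missing-data model -/

/-- The space of triples `(t, y, x)` with `t` a missingness indicator (coded in `{0, 1}`), `y` an
outcome and `x` a vector of `p` covariates. -/
abbrev Triple (p : ℕ) : Type := ℝ × ℝ × (Fin p → ℝ)

/-- The indicator coordinate. -/
def tCoord {p : ℕ} (z : Triple p) : ℝ := z.1

/-- The outcome coordinate. -/
def yCoord {p : ℕ} (z : Triple p) : ℝ := z.2.1

/-- The covariate coordinate. -/
def xCoord {p : ℕ} (z : Triple p) : Fin p → ℝ := z.2.2

/-- Only `(T, T Y, X)` is observed. -/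
def observe {p : ℕ} (z : Triple p) : Triple p := (tCoord z, tCoord z * yCoord z, xCoord z)

lemma measurable_xCoord {p : ℕ} : Measurable (xCoord (p := p)) :=
  measurable_snd.comp measurable_snd

/-- The sigma-algebra generated by the covariates. -/
abbrev xSigma (p : ℕ) : MeasurableSpace (Triple p) :=
  MeasurableSpace.comap xCoord inferInstance

/-- The support of the covariate vector. -/
def xSupport {p : ℕ} (P : Measure (Triple p)) : Set (Fin p → ℝ) := (P.map xCoord).support

/-- `P` is the joint law of the full triple `(T, Y, X)`; the outcome is missing at random,
`prop` is the propensity score `x ↦ P(T = 1 | X = x)`, bounded below by `δ` on the support of `X`,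
and `m` is the outcome regression `x ↦ E(Y | X = x)`. -/
structure IsMissingDataModel {p : ℕ} (P : Measure (Triple p)) [IsProbabilityMeasure P]
    (prop m : (Fin p → ℝ) → ℝ) (δ : ℝ) : Prop where
  binary : ∀ᵐ z ∂P, tCoord z = 0 ∨ tCoord z = 1
  integrable_outcome : Integrable yCoord P
  ignorability :
    CondIndepFun (xSigma p) measurable_xCoord.comap_le (tCoord (p := p)) (yCoord (p := p)) P
  measurable_prop : Measurable prop
  propensity : (fun z => prop (xCoord z)) =ᵐ[P] P⟦{z : Triple p | tCoord z = 1} | xSigma p⟧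
  overlap : ∀ x ∈ xSupport P, δ ≤ prop x
  measurable_regression : Measurable m
  regression : (fun z => m (xCoord z)) =ᵐ[P] P[(yCoord (p := p)) | xSigma p]

/-! ### Orlicz norms and moments -/

/-- The Orlicz norm `inf {c > 0 : E [exp ((|f| / c) ^ α) - 1] ≤ 1}`, equal to `∞` when the set is
empty. -/
def orliczNorm {Ω : Type*} [MeasurableSpace Ω] (α : ℝ) (f : Ω → ℝ) (μ : Measure Ω) : ℝ≥0∞ :=
  sInf {c : ℝ≥0∞ | ∃ r : ℝ, 0 < r ∧ c = ENNReal.ofReal r ∧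
    ∫⁻ ω, ENNReal.ofReal (Real.exp ((|f ω| / r) ^ α) - 1) ∂μ ≤ 1}

/-- The Orlicz norm of a random vector: the maximum over the coordinates. -/
def orliczNormVec {Ω : Type*} [MeasurableSpace Ω] {d : ℕ} (α : ℝ) (f : Ω → Fin d → ℝ)
    (μ : Measure Ω) : ℝ≥0∞ :=
  ⨆ j, orliczNorm α (fun ω => f ω j) μ

/-- The largest second moment `max_j E [h_j(X)^2]`. -/
def maxSecondMoment {p d : ℕ} (P : Measure (Triple p)) (h : (Fin p → ℝ) → Fin d → ℝ) : ℝ :=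
  ⨆ j, ∫ z, (h (xCoord z) j) ^ 2 ∂P

/-! ### Sample splitting and cross-fitting -/

/-- A partition of `2 * N` indices into two folds of size `N`, given by fold labels. -/
abbrev Split (N : ℕ) : Type :=
  {s : Fin (2 * N) → Fin 2 // ∀ k, (Finset.univ.filter (fun i => s i = k)).card = N}

/-- The part of the data with fold label `k`, listed in increasing order of the index. -/
def subsample {N p : ℕ} (s : Split N) (k : Fin 2) (z : Fin (2 * N) → Triple p) :
    Fin N → Triple p :=
  fun a => z ((Finset.univ.filter (fun i => s.1 i = k)).orderEmbOfFin (s.2 k) a)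

/-- The cross-fitted estimate at the `i`-th covariate: the estimation procedure `mhat` is applied
to the fold not containing `i` (`Fin.rev` exchanges the two labels). -/
def crossFitted {N p : ℕ} (mhat : (Fin N → Triple p) → (Fin p → ℝ) → ℝ) (s : Split N)
    (z : Fin (2 * N) → Triple p) (i : Fin (2 * N)) : ℝ :=
  mhat (subsample s (Fin.rev (s.1 i)) z) (xCoord (z i))

/-- The error term
`n⁻¹ ∑ i, (T_i / prop(X_i) - 1) * (crossFitted i - m(X_i)) * h(X_i)` with `n = 2 * N`. -/
def errorTerm {N p d : ℕ} (prop m : (Fin p → ℝ) → ℝ) (h : (Fin p → ℝ) → Fin d → ℝ)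
    (mhat : (Fin N → Triple p) → (Fin p → ℝ) → ℝ) (s : Split N)
    (z : Fin (2 * N) → Triple p) : Fin d → ℝ :=
  fun j => ((2 * N : ℕ) : ℝ)⁻¹ * ∑ i, (tCoord (z i) / prop (xCoord (z i)) - 1) *
    (crossFitted mhat s z i - m (xCoord (z i))) * h (xCoord (z i)) j

/-- Pointwise tail bound: when `mhat` is computed from `N` i.i.d. observations, then for every `x`
in the support of the covariates and `t ≥ 0`, the probability of `|mhat(x) - m(x)| > t v` is at most
`C exp(-t²) + q`. -/
def HasPointwiseTail {N p : ℕ} (P : Measure (Triple p)) (m : (Fin p → ℝ) → ℝ)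
    (mhat : (Fin N → Triple p) → (Fin p → ℝ) → ℝ) (C v q : ℝ) : Prop :=
  ∀ x ∈ xSupport P, ∀ t : ℝ, 0 ≤ t →
    (Measure.pi (fun _ : Fin N => P.map observe)).real {D | t * v < |mhat D x - m x|}
      ≤ C * Real.exp (-t ^ 2) + q

/-- `Z` is an i.i.d. sample of the observable vector `(T, T Y, X)`, and `S` is a random split of it
that is independent of the data. -/
structure IsSplitSample {Ω : Type*} [MeasurableSpace Ω] {N p : ℕ} (μ : Measure Ω)
    (P : Measure (Triple p)) (Z : Fin (2 * N) → Ω → Triple p) (S : Ω → Split N) : Prop where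
  measurable_obs : ∀ i, Measurable (Z i)
  law_obs : ∀ i, μ.map (Z i) = P.map observe
  indep_obs : iIndepFun Z μ
  measurable_split : Measurable S
  indep_split : IndepFun S (fun ω i => Z i ω) μ

/-! ### The constants and the bound -/

/-- `1/2` at `a = 1/2`, `0` at `a = 1`, and `√((a - 1/2) / log (a / (1 - a)))` otherwise. -/
def tildeConst (a : ℝ) : ℝ :=
  if a = 1 / 2 then 1 / 2
  else if a = 1 then 0
  else Real.sqrt ((a - 1 / 2) / Real.log (a / (1 - a)))

/-- The constant obtained from the lower bound `δ` of the propensity score. -/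
def barConst (a : ℝ) : ℝ := 2 * tildeConst a / a

/-- `C₁* = 4 c₁ δ̄`. -/
def C1star (c₁ δ : ℝ) : ℝ := 4 * c₁ * barConst δ

/-- `C₂* = √2 c₂ (√2 σ_m + K_m)` with `σ_m = 2 √2 σ_h²` and `K_m = 2 σ_h²`. -/
def C2star (c₂ σh : ℝ) : ℝ :=
  Real.sqrt 2 * c₂ * (Real.sqrt 2 * (2 * Real.sqrt 2 * σh ^ 2) + 2 * σh ^ 2)

/-- The bound
`c √(log d / n) (v √(log (n d))) C₁* (M + C₂* √(log d / n)) ^ (1/2)` with `n = 2 * N`. -/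
def rateBound (c c₁ c₂ δ σh M v : ℝ) (N d : ℕ) : ℝ :=
  c * Real.sqrt (Real.log d / (2 * N)) * (v * Real.sqrt (Real.log (2 * N * d))) * C1star c₁ δ *
    Real.sqrt (M + C2star c₂ σh * Real.sqrt (Real.log d / (2 * N)))

end CrossFit

end

namespace CrossFit

/-! Cross-fitting makes the estimate independent of the fold on which it is evaluated. Once that
estimate is frozen, the error over a fold is a sum of i.i.d. terms `(T / π(X) - 1) u(X)` with `u`
deterministic. Given `X` the weight is centred and sub-Gaussian with a proxy depending only on `δ`
(`weight_mgf_le`). Hence the exponential of the term, compensated by `2 * barConst δ ^ 2 * u(X) ^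
2`, has mean at most one (`IsMissingDataModel.lintegral_exp_le`).

Chernoff's bound then gives a self-normalised tail, valid on the event that `∑ u(X) ^ 2` is at most
`V` (`IsMissingDataModel.weighted_sum_tail`). Two events supply `V`: the estimation error is small
at all covariates of the fold, by the pointwise tail and a union bound, and the empirical second
moments of `h` are close to their means (`sum_sq_tail`). A union over coordinates, signs and the two
folds gives the finite-sample bound.

For the `o_P` claim, fixed constants do not suffice: if `d` stays bounded, the failure probability
need not vanish. Given a target `η`, the constant `c` is replaced by one depending on `η`, and `c₂`
by one growing with `N` where there is room (`exists_enlarged_constant`). The bound remains of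
smaller order because `v √(log (n d))` tends to zero. -/

/-! ### Scalar inequalities: Bernoulli moment generating functions and the propensity constant. -/

lemma exp_le_add_exp_sq (x : ℝ) : Real.exp x ≤ x + Real.exp (x ^ 2) := by
  have h1 := Real.add_one_le_exp (x ^ 2)
  rcases le_or_gt |x| 1 with hx | hx
  · have := (abs_le.mp (Real.abs_exp_sub_one_sub_id_le hx)).2
    linarith
  · rcases lt_abs.mp hx with hx | hx
    · have : Real.exp x ≤ Real.exp (x ^ 2) := Real.exp_le_exp.mpr (by nlinarith)
      linarith
    · have : Real.exp x ≤ 1 := Real.exp_le_one_iff.mpr (by linarith)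
      nlinarith

lemma exp_sub_one_sub_id_le_mul_exp (t : ℝ) {b : ℝ} (hb : 0 ≤ b) (htb : t ≤ b) :
    Real.exp t - 1 - t ≤ t ^ 2 * Real.exp b := by
  have hb1 : 1 ≤ Real.exp b := Real.one_le_exp hb
  rcases le_or_gt t 0 with ht | ht
  · rcases le_or_gt (-1) t with h1 | h1
    · have := (abs_le.mp (Real.abs_exp_sub_one_sub_id_le (abs_le.mpr ⟨h1, by linarith⟩))).2
      nlinarith [sq_nonneg t]
    · have : Real.exp t ≤ 1 := Real.exp_le_one_iff.mpr ht
      nlinarith [sq_nonneg t]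
  · have h1 : 1 - t ≤ Real.exp (-t) := by linarith [Real.add_one_le_exp (-t)]
    have h2 : Real.exp t * Real.exp (-t) = 1 := by rw [← Real.exp_add]; simp
    have h3 : Real.exp t ≤ Real.exp b := Real.exp_le_exp.mpr htb
    have h4 : Real.exp t * (1 - t) ≤ 1 := by
      exact (mul_le_mul_of_nonneg_left h1 (Real.exp_pos t).le).trans_eq h2
    have h5 : Real.exp t - 1 ≤ t * Real.exp t := by nlinarith
    have h6 : t * (Real.exp t - 1) ≤ t * (t * Real.exp t) := mul_le_mul_of_nonneg_left h5 ht.le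
    nlinarith [sq_nonneg t, mul_le_mul_of_nonneg_left h3 (sq_nonneg t)]

/-- A Kearns–Saul type bound for success probabilities below `1 / 2`, up to a constant in the
exponent. -/
lemma bernoulli_mgf_le_of_lt_half {p : ℝ} (hp : 0 < p) (hp2 : p < 1 / 2) (t : ℝ) :
    p * Real.exp (t * (1 - p)) + (1 - p) * Real.exp (-(t * p)) ≤
      Real.exp (8 * ((p - 1 / 2) / Real.log (p / (1 - p))) * t ^ 2) := by
  have hq : 0 < 1 - p := by linarith
  set a := Real.log ((1 - p) / p) with ha
  have hneg : Real.log (p / (1 - p)) = -a := by rw [ha, ← Real.log_inv, inv_div]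
  have ha0 : 0 < a := Real.log_pos (by rw [lt_div_iff₀ hp]; linarith)
  have hcoef : (p - 1 / 2) / Real.log (p / (1 - p)) = (1 - 2 * p) / (2 * a) := by
    rw [hneg]; field_simp; ring
  rw [hcoef]
  -- For `p ≥ 1/4` the coefficient of `t ^ 2` on the right is at least one, so the crude bound `exp
  -- (t ^ 2)` is enough; it follows from `exp x ≤ x + exp (x ^ 2)`, whose linear terms cancel in the
  -- average.
  rcases le_or_gt (1 / 4) p with h4 | h4
  · have ha4 : a ≤ 4 * (1 - 2 * p) := by
      have h1 := Real.log_le_sub_one_of_pos (div_pos hq hp)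
      have h2 : (1 - p) / p - 1 ≤ 4 * (1 - 2 * p) := by
        rw [div_sub_one hp.ne', div_le_iff₀ hp]; nlinarith
      linarith
    have hc : 1 ≤ 8 * ((1 - 2 * p) / (2 * a)) := by
      rw [← mul_div_assoc, le_div_iff₀ (by positivity)]; linarith
    have hA : Real.exp (t * (1 - p)) ≤ t * (1 - p) + Real.exp (t ^ 2) :=
      (exp_le_add_exp_sq _).trans (add_le_add_right (Real.exp_le_exp.mpr (by
        rw [mul_pow]; exact mul_le_of_le_one_right (sq_nonneg t) (by nlinarith))) _)
    have hB : Real.exp (-(t * p)) ≤ -(t * p) + Real.exp (t ^ 2) :=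
      (exp_le_add_exp_sq _).trans (add_le_add_right (Real.exp_le_exp.mpr (by
        rw [neg_sq, mul_pow]; exact mul_le_of_le_one_right (sq_nonneg t) (by nlinarith))) _)
    calc _ ≤ p * (t * (1 - p) + Real.exp (t ^ 2)) + (1 - p) * (-(t * p) + Real.exp (t ^ 2)) := by
          gcongr
      _ = Real.exp (t ^ 2) := by ring
      _ ≤ _ := Real.exp_le_exp.mpr (by nlinarith [sq_nonneg t])
  -- The threshold `a / 2` balances two regimes. Below it, `p * exp (a / 2) = √(p (1 - p))` controls
  -- the quadratic remainder; above it, both exponents are at most `t`, and `t` is already dominated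
  -- by the right-hand exponent.
  · rcases le_or_gt t (a / 2) with hta | hta
    · have h1 : p * Real.exp (t * (1 - p)) + (1 - p) * Real.exp (-(t * p)) =
          Real.exp (-(t * p)) * (1 + p * (Real.exp t - 1)) := by
        have : Real.exp (t * (1 - p)) = Real.exp (-(t * p)) * Real.exp t := by
          rw [← Real.exp_add]; ring_nf
        rw [this]; ring
      have h2 : 1 + p * (Real.exp t - 1) ≤ Real.exp (p * (Real.exp t - 1)) := by
        linarith [Real.add_one_le_exp (p * (Real.exp t - 1))]
      rw [h1]
      refine (mul_le_mul_of_nonneg_left h2 (Real.exp_pos _).le).trans ?_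
      rw [← Real.exp_add]
      refine Real.exp_le_exp.mpr ?_
      have h3 := exp_sub_one_sub_id_le_mul_exp t (by linarith) hta
      set e := Real.exp (a / 2) with he
      have hee : e * e * p = 1 - p := by
        rw [he, ← Real.exp_add, add_halves, ha, Real.exp_log (div_pos hq hp)]; field_simp
      have he0 : 0 < e := Real.exp_pos _
      have hae : a ≤ 2 * e := by
        have := Real.add_one_le_exp (a / 2); linarith
      have hpe : p * e ≤ 8 * ((1 - 2 * p) / (2 * a)) := by
        rw [← mul_div_assoc, le_div_iff₀ (by positivity)]
        have : p * e * (2 * a) ≤ p * e * (2 * (2 * e)) := by gcongr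
        nlinarith
      calc -(t * p) + p * (Real.exp t - 1) = p * (Real.exp t - 1 - t) := by ring
        _ ≤ p * (t ^ 2 * e) := by gcongr
        _ = p * e * t ^ 2 := by ring
        _ ≤ _ := by gcongr
    · have ht : 0 < t := by linarith
      have hA : Real.exp (t * (1 - p)) ≤ Real.exp t := Real.exp_le_exp.mpr (by nlinarith)
      have hB : Real.exp (-(t * p)) ≤ Real.exp t := Real.exp_le_exp.mpr (by nlinarith)
      calc _ ≤ p * Real.exp t + (1 - p) * Real.exp t := by gcongr
        _ = Real.exp t := by ring
        _ ≤ _ := by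
          refine Real.exp_le_exp.mpr ?_
          have hc : 1 ≤ 8 * ((1 - 2 * p) / (2 * a)) * t := by
            rw [← mul_div_assoc, div_mul_eq_mul_div, le_div_iff₀ (by positivity)]
            nlinarith
          nlinarith

/-- Numerator and logarithm change sign together at `1 / 2`, so the square root is never truncated
to zero. -/
lemma sq_tildeConst_of_ne {a : ℝ} (h0 : 0 < a) (h1 : a < 1) (h2 : a ≠ 1 / 2) :
    tildeConst a ^ 2 = (a - 1 / 2) / Real.log (a / (1 - a)) := by
  rw [tildeConst, if_neg h2, if_neg h1.ne, Real.sq_sqrt]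
  rcases lt_or_gt_of_ne h2 with h | h
  · refine div_nonneg_of_nonpos (by linarith) (Real.log_nonpos ?_ ?_)
    · exact div_nonneg h0.le (by linarith)
    · rw [div_le_one (by linarith)]; linarith
  · refine div_nonneg (by linarith) (Real.log_nonneg ?_)
    rw [le_div_iff₀ (by linarith)]; linarith

lemma tildeConst_nonneg (a : ℝ) : 0 ≤ tildeConst a := by
  unfold tildeConst; split_ifs <;> positivity

/-- A centred Bernoulli variable is sub-Gaussian with variance proxy at most
`16 * tildeConst p ^ 2`. -/
lemma bernoulli_mgf_le {p : ℝ} (hp : 0 < p) (hp1 : p ≤ 1) (t : ℝ) :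
    p * Real.exp (t * (1 - p)) + (1 - p) * Real.exp (-(t * p)) ≤
      Real.exp (8 * tildeConst p ^ 2 * t ^ 2) := by
  rcases hp1.eq_or_lt with rfl | hp1
  · simp only [sub_self, mul_zero, Real.exp_zero, mul_one, zero_mul, add_zero]
    exact Real.one_le_exp (by positivity)
  rcases lt_trichotomy p (1 / 2) with h | h | h
  · rw [sq_tildeConst_of_ne hp hp1 h.ne]; exact bernoulli_mgf_le_of_lt_half hp h t
  · subst h
    have hA := exp_le_add_exp_sq (t * (1 - 1 / 2))
    have hB := exp_le_add_exp_sq (-(t * (1 / 2)))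
    have hA' : Real.exp ((t * (1 - 1 / 2)) ^ 2) ≤ Real.exp (8 * tildeConst (1 / 2) ^ 2 * t ^ 2) :=
      Real.exp_le_exp.mpr (by rw [tildeConst, if_pos rfl]; nlinarith [sq_nonneg t])
    have hB' : Real.exp ((-(t * (1 / 2))) ^ 2) ≤ Real.exp (8 * tildeConst (1 / 2) ^ 2 * t ^ 2) :=
      Real.exp_le_exp.mpr (by rw [tildeConst, if_pos rfl]; nlinarith [sq_nonneg t])
    linarith
  · rw [sq_tildeConst_of_ne hp hp1 h.ne']
    -- Exchanging success and failure: the substitution `(p, t) ↦ (1 - p, -t)` preserves both sides.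
    have key := bernoulli_mgf_le_of_lt_half (p := 1 - p) (by linarith) (by linarith) (-t)
    have hlog : Real.log ((1 - p) / (1 - (1 - p))) = -Real.log (p / (1 - p)) := by
      rw [← Real.log_inv, inv_div]; simp
    rw [hlog] at key
    have hc : (1 - p - 1 / 2) / -Real.log (p / (1 - p)) = (p - 1 / 2) / Real.log (p / (1 - p)) := by
      rw [← neg_div_neg_eq]; simp only [neg_neg]; congr 1; ring
    rw [hc, neg_sq] at key
    refine le_trans (le_of_eq ?_) key
    ring_nf

lemma barConst_nonneg {a : ℝ} (ha : 0 < a) : 0 ≤ barConst a :=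
  div_nonneg (mul_nonneg zero_le_two (tildeConst_nonneg a)) ha.le

/-- The centred inverse-probability weight is sub-Gaussian, uniformly over propensities bounded
below by `δ`. -/
lemma weight_mgf_le {δ π : ℝ} (hδ : 0 < δ) (hδπ : δ ≤ π) (hπ1 : π ≤ 1) (y : ℝ) :
    π * Real.exp (y * (1 / π - 1)) + (1 - π) * Real.exp (-y) ≤
      Real.exp (2 * barConst δ ^ 2 * y ^ 2) := by
  have hπ : 0 < π := hδ.trans_le hδπ
  have hw : δ / π ≤ 1 := (div_le_one hπ).mpr hδπ
  -- Since `y / π` lies between `0` and `y / δ`, convexity of `exp` shows that the left side at `π`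
  -- is at most its value at `δ`, so the worst propensity is `δ` itself.
  have hconv := convexOn_exp.2 (Set.mem_univ (y / δ)) (Set.mem_univ (0 : ℝ))
    (div_nonneg hδ.le hπ.le) (sub_nonneg.mpr hw) (by ring)
  simp only [smul_eq_mul, mul_zero, add_zero, Real.exp_zero, mul_one] at hconv
  have h1 : δ / π * (y / δ) = y / π := by field_simp
  rw [h1] at hconv
  have h2 : π * Real.exp (y / π) ≤ δ * Real.exp (y / δ) + (π - δ) := by
    calc _ ≤ π * (δ / π * Real.exp (y / δ) + (1 - δ / π)) := by gcongr
      _ = _ := by field_simp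
  have h3 : ∀ a : ℝ, a ≠ 0 → a * Real.exp (y * (1 / a - 1)) + (1 - a) * Real.exp (-y) =
      Real.exp (-y) * (a * Real.exp (y / a) + 1 - a) := by
    intro a ha
    have : y * (1 / a - 1) = -y + y / a := by ring
    rw [this, Real.exp_add]; ring
  have key := bernoulli_mgf_le hδ (hδπ.trans hπ1) (y / δ)
  have e1 : y / δ * (1 - δ) = y * (1 / δ - 1) := by field_simp
  have e2 : y / δ * δ = y := by field_simp
  have e3 : 8 * tildeConst δ ^ 2 * (y / δ) ^ 2 = 2 * barConst δ ^ 2 * y ^ 2 := by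
    rw [barConst]; ring
  rw [e1, e2, e3, h3 δ hδ.ne'] at key
  rw [h3 π hπ.ne']
  refine le_trans ?_ key
  gcongr Real.exp (-y) * ?_
  linarith

/-- With `x = 2 a - 1`, the logarithm is `log (1 + x) - log (1 - x)`, an odd power series with
nonnegative terms for `x > 0`; the bound keeps its first term `2 x`. -/
lemma log_div_one_sub_ge {a : ℝ} (h : 1 / 2 < a) (h1 : a < 1) :
    4 * (a - 1 / 2) ≤ Real.log (a / (1 - a)) := by
  have hx : |2 * a - 1| < 1 := abs_lt.mpr ⟨by linarith, by linarith⟩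
  have hs := Real.hasSum_log_sub_log_of_abs_lt_one hx
  have h0 := hs.summable.sum_le_tsum {0} (fun i _ => by
    have : 0 ≤ 2 * a - 1 := by linarith
    positivity)
  rw [hs.tsum_eq] at h0
  simp only [Finset.sum_singleton] at h0
  have : Real.log (a / (1 - a)) = Real.log (1 + (2 * a - 1)) - Real.log (1 - (2 * a - 1)) := by
    rw [← Real.log_div (by linarith) (by linarith)]
    rw [show 1 + (2 * a - 1) = 2 * a by ring, show 1 - (2 * a - 1) = 2 * (1 - a) by ring,
      mul_div_mul_left _ _ two_ne_zero]
  rw [this]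
  norm_num at h0 ⊢
  linarith

lemma tildeConst_le_half {a : ℝ} (h0 : 0 < a) (h1 : a ≤ 1) : tildeConst a ≤ 1 / 2 := by
  rcases h1.eq_or_lt with rfl | h1
  · norm_num [tildeConst]
  rcases eq_or_ne a (1 / 2) with h | h
  · rw [tildeConst, if_pos h]
  refine le_of_sq_le_sq ?_ (by norm_num)
  rw [sq_tildeConst_of_ne h0 h1 h]
  rcases lt_or_gt_of_ne h with h | h
  · have := log_div_one_sub_ge (a := 1 - a) (by linarith) (by linarith)
    have hlog : Real.log ((1 - a) / (1 - (1 - a))) = -Real.log (a / (1 - a)) := by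
      rw [← Real.log_inv, inv_div]; simp
    rw [hlog] at this
    rw [div_le_iff_of_neg (by linarith)]
    linarith
  · have := log_div_one_sub_ge h h1
    rw [div_le_iff₀ (by linarith)]
    linarith

lemma barConst_le_inv {a : ℝ} (h0 : 0 < a) (h1 : a ≤ 1) : barConst a ≤ a⁻¹ := by
  rw [barConst, ← one_div]
  gcongr
  linarith [tildeConst_le_half h0 h1]

/-- Scaling the remainder of the exponential series. -/
lemma exp_mul_le {ε u : ℝ} (hε : 0 ≤ ε) (hε1 : ε ≤ 1) (hu : 0 ≤ u) :
    Real.exp (ε * u) ≤ 1 + ε * u + ε ^ 2 * (Real.exp u - 1 - u) := by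
  let D : ℝ → ℝ := fun x => 1 + ε * x + ε ^ 2 * (Real.exp x - 1 - x) - Real.exp (ε * x)
  have hD : ∀ x, HasDerivAt D (ε + ε ^ 2 * (Real.exp x - 1) - Real.exp (ε * x) * ε) x := by
    intro x
    have h1 : HasDerivAt (fun x : ℝ => ε * x) ε x := by
      simpa using (hasDerivAt_id x).const_mul ε
    have h2 := (((Real.hasDerivAt_exp x).sub_const 1).sub (hasDerivAt_id x)).const_mul (ε ^ 2)
    exact ((h1.const_add 1).add h2).sub h1.exp
  -- The derivative of `D` is `ε` times `1 + ε (exp x - 1) - exp (ε x)`, nonnegative by convexity of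
  -- `exp`.
  have hmono : MonotoneOn D (Set.Ici 0) := by
    refine monotoneOn_of_deriv_nonneg (convex_Ici 0)
      (fun x _ => (hD x).continuousAt.continuousWithinAt)
      (fun x _ => (hD x).differentiableAt.differentiableWithinAt) (fun x _ => ?_)
    rw [(hD x).deriv]
    have hconv := convexOn_exp.2 (Set.mem_univ x) (Set.mem_univ (0 : ℝ)) hε
      (sub_nonneg.mpr hε1) (by ring)
    simp only [smul_eq_mul, mul_zero, add_zero, Real.exp_zero, mul_one] at hconv
    nlinarith
  have := hmono (Set.mem_Ici.mpr le_rfl) (Set.mem_Ici.mpr hu) hu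
  simp only [D, mul_zero, Real.exp_zero] at this
  linarith

/-! ### Product measures -/

/-- Conditioning by Tonelli. Freezing the left factor serves for the covariates of a fold and for
the random split; freezing the right factor serves for the fold that produces the estimate. -/
lemma prod_real_le_of_left {α β : Type*} [MeasurableSpace α] [MeasurableSpace β]
    {μ : Measure α} {ν : Measure β} [IsProbabilityMeasure μ] [IsProbabilityMeasure ν]
    {s : Set (α × β)} (hs : MeasurableSet s) {b : ℝ} (hb : 0 ≤ b)
    (h : ∀ᵐ x ∂μ, ν.real (Prod.mk x ⁻¹' s) ≤ b) : (μ.prod ν).real s ≤ b := by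
  refine ENNReal.toReal_le_of_le_ofReal hb ?_
  rw [Measure.prod_apply hs]
  calc _ ≤ ∫⁻ _, ENNReal.ofReal b ∂μ := by
        refine lintegral_mono_ae (h.mono fun x hx => ?_)
        rw [← ENNReal.ofReal_toReal (measure_ne_top ν _)]
        exact ENNReal.ofReal_le_ofReal hx
    _ = _ := by simp

lemma prod_real_le_of_right {α β : Type*} [MeasurableSpace α] [MeasurableSpace β]
    {μ : Measure α} {ν : Measure β} [IsProbabilityMeasure μ] [IsProbabilityMeasure ν]
    {s : Set (α × β)} (hs : MeasurableSet s) {b : ℝ} (hb : 0 ≤ b)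
    (h : ∀ᵐ y ∂ν, μ.real ((fun x => (x, y)) ⁻¹' s) ≤ b) : (μ.prod ν).real s ≤ b := by
  refine ENNReal.toReal_le_of_le_ofReal hb ?_
  rw [Measure.prod_apply_symm hs]
  calc _ ≤ ∫⁻ _, ENNReal.ofReal b ∂ν := by
        refine lintegral_mono_ae (h.mono fun x hx => ?_)
        rw [← ENNReal.ofReal_toReal (measure_ne_top μ _)]
        exact ENNReal.ofReal_le_ofReal hx
    _ = _ := by simp

/-- Splitting the coordinates of a product of copies of one law into two blocks. -/
lemma measurePreserving_split {α ι κ τ : Type*} [Fintype ι] [Fintype κ] [Fintype τ]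
    [MeasurableSpace α] (Q : Measure α) [IsProbabilityMeasure Q] (e : ι ⊕ κ ≃ τ) :
    MeasurePreserving (fun z : τ → α => (fun a => z (e (Sum.inl a)), fun b => z (e (Sum.inr b))))
      (Measure.pi fun _ => Q) ((Measure.pi fun _ => Q).prod (Measure.pi fun _ => Q)) := by
  have h1 := (measurePreserving_piCongrLeft (fun _ : τ => Q) e).symm
  have h2 := measurePreserving_sumPiEquivProdPi (fun _ : ι ⊕ κ => Q)
  exact h2.comp h1

/-- Chernoff's bound for sums of independent copies. -/
lemma pi_sum_tail {α ι : Type*} [Fintype ι] [MeasurableSpace α] {Q : Measure α}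
    [IsProbabilityMeasure Q] {G : α → ℝ} (hG : Measurable G)
    (hint : ∫⁻ z, ENNReal.ofReal (Real.exp (G z)) ∂Q ≤ 1) (s : ℝ) :
    (Measure.pi fun _ : ι => Q).real {D | s ≤ ∑ a, G (D a)} ≤ Real.exp (-s) := by
  have hF : Measurable fun z => ENNReal.ofReal (Real.exp (G z)) :=
    (Real.measurable_exp.comp hG).ennreal_ofReal
  have hind : iIndepFun (fun (a : ι) (D : ι → α) => ENNReal.ofReal (Real.exp (G (D a))))
      (Measure.pi fun _ => Q) :=
    iIndepFun_pi (X := fun _ z => ENNReal.ofReal (Real.exp (G z))) fun _ => hF.aemeasurable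
  have hprod := lintegral_prod_eq_prod_lintegral_of_indepFun Finset.univ _ hind
    (fun a => hF.comp (measurable_pi_apply a))
  have hle : ∫⁻ D : ι → α, ∏ a, ENNReal.ofReal (Real.exp (G (D a))) ∂(Measure.pi fun _ => Q)
      ≤ 1 := by
    rw [hprod]
    refine Finset.prod_le_one' fun a _ => ?_
    rwa [(measurePreserving_eval (fun _ : ι => Q) a).lintegral_comp hF]
  have hM := mul_meas_ge_le_lintegral (μ := Measure.pi fun _ : ι => Q)
    (f := fun D => ∏ a, ENNReal.ofReal (Real.exp (G (D a))))
    (Finset.measurable_prod _ fun a _ => hF.comp (measurable_pi_apply a))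
    (ENNReal.ofReal (Real.exp s))
  have hset : {D : ι → α | s ≤ ∑ a, G (D a)} ⊆
      {D | ENNReal.ofReal (Real.exp s) ≤ ∏ a, ENNReal.ofReal (Real.exp (G (D a)))} := by
    intro D hD
    simp only [Set.mem_ofPred_eq] at hD ⊢
    rw [← ENNReal.ofReal_prod_of_nonneg fun a _ => (Real.exp_pos _).le, ← Real.exp_sum]
    exact ENNReal.ofReal_le_ofReal (Real.exp_le_exp.mpr hD)
  refine ENNReal.toReal_le_of_le_ofReal (Real.exp_pos _).le ?_
  rw [Real.exp_neg, ENNReal.ofReal_inv_of_pos (Real.exp_pos _), ENNReal.le_inv_iff_mul_le,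
    mul_comm]
  exact (mul_le_mul_right (measure_mono hset) _).trans (hM.trans hle)

/-- Continuity from below. It removes strictness assumptions: a bound proved at slightly enlarged
thresholds passes to the limit threshold. -/
lemma measureReal_lt_le_of_antitone {α : Type*} [MeasurableSpace α] {μ : Measure α}
    [IsProbabilityMeasure μ] {A : Set α} {g : α → ℝ} {c : ℕ → ℝ} {c₀ b : ℝ}
    (hb : 0 ≤ b) (hanti : Antitone c) (hc : Tendsto c atTop (𝓝 c₀))
    (h : ∀ n, μ.real {x | c n < g x ∧ x ∈ A} ≤ b) : μ.real {x | c₀ < g x ∧ x ∈ A} ≤ b := by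
  refine ENNReal.toReal_le_of_le_ofReal hb ?_
  have hmono : Monotone fun n => {x | c n < g x ∧ x ∈ A} :=
    fun m n hmn x hx => ⟨(hanti hmn).trans_lt hx.1, hx.2⟩
  have hsub : {x | c₀ < g x ∧ x ∈ A} ⊆ ⋃ n, {x | c n < g x ∧ x ∈ A} := by
    intro x hx
    obtain ⟨n, hn⟩ := (hc.eventually_lt_const hx.1).exists
    exact Set.mem_iUnion.mpr ⟨n, hn, hx.2⟩
  refine (measure_mono hsub).trans ?_
  rw [hmono.measure_iUnion]
  refine iSup_le fun n => ?_
  rw [← ENNReal.ofReal_toReal (measure_ne_top μ _)]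
  exact ENNReal.ofReal_le_ofReal (h n)

/-! ### Squares of sub-Gaussian variables -/

/-- The strict inequality yields an admissible scale `r` without having to show that the infimum
defining the Orlicz norm is attained. -/
lemma exists_exp_sq_integral_le {α : Type*} [MeasurableSpace α] {Q : Measure α} {f : α → ℝ}
    (hf : Measurable f) {R : ℝ} (h : orliczNorm 2 f Q < ENNReal.ofReal R) :
    ∃ r, 0 < r ∧ r < R ∧ Integrable (fun z => Real.exp (f z ^ 2 / r ^ 2) - 1) Q ∧
      ∫ z, (Real.exp (f z ^ 2 / r ^ 2) - 1) ∂Q ≤ 1 := by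
  obtain ⟨c, ⟨r, hr, rfl, hint⟩, hlt⟩ := sInf_lt_iff.mp h
  have hrw : ∀ z, (|f z| / r) ^ (2 : ℝ) = f z ^ 2 / r ^ 2 := fun z => by
    rw [Real.rpow_two, div_pow, sq_abs]
  simp only [hrw] at hint
  have hnn : ∀ z, 0 ≤ Real.exp (f z ^ 2 / r ^ 2) - 1 := fun z =>
    sub_nonneg.mpr (Real.one_le_exp (by positivity))
  have hm : Measurable fun z => Real.exp (f z ^ 2 / r ^ 2) - 1 := by fun_prop
  have hi : Integrable (fun z => Real.exp (f z ^ 2 / r ^ 2) - 1) Q :=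
    ⟨hm.aestronglyMeasurable, by
      rw [hasFiniteIntegral_iff_ofReal (Eventually.of_forall hnn)]
      exact hint.trans_lt ENNReal.one_lt_top⟩
  refine ⟨r, hr, (ENNReal.ofReal_lt_ofReal_iff_of_nonneg hr.le).mp hlt, hi, ?_⟩
  rw [integral_eq_lintegral_of_nonneg_ae (Eventually.of_forall hnn) hm.aestronglyMeasurable]
  exact ENNReal.toReal_le_of_le_ofReal zero_le_one (by simpa using hint)

lemma integrable_sq_div_of_exp {α : Type*} [MeasurableSpace α] {Q : Measure α} {f : α → ℝ}
    (hf : Measurable f) {r : ℝ}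
    (hi : Integrable (fun z => Real.exp (f z ^ 2 / r ^ 2) - 1) Q) :
    Integrable (fun z => f z ^ 2 / r ^ 2) Q := by
  refine hi.mono' (by fun_prop) (Eventually.of_forall fun z => ?_)
  rw [Real.norm_of_nonneg (by positivity)]
  linarith [Real.add_one_le_exp (f z ^ 2 / r ^ 2)]

lemma integral_sq_le_of_orliczNorm {α : Type*} [MeasurableSpace α] {Q : Measure α} {f : α → ℝ}
    (hf : Measurable f) {R : ℝ} (h : orliczNorm 2 f Q < ENNReal.ofReal R) :
    ∫ z, f z ^ 2 ∂Q ≤ R ^ 2 := by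
  obtain ⟨r, hr, hrR, hi, hle⟩ := exists_exp_sq_integral_le hf h
  have h1 : ∫ z, f z ^ 2 / r ^ 2 ∂Q ≤ 1 :=
    (integral_mono (integrable_sq_div_of_exp hf hi) hi fun z => by
      linarith [Real.add_one_le_exp (f z ^ 2 / r ^ 2)]).trans hle
  rw [integral_div, div_le_one (by positivity)] at h1
  nlinarith

/-- Chernoff with `u = f ^ 2 / r ^ 2` and exponent `ε` itself. By `exp_mul_le` the moment generating
function of `u` at `ε` is at most `exp (ε E + ε ^ 2)`. A deviation of `2 ε` per term therefore
leaves `2 ε ^ 2 - ε ^ 2 = ε ^ 2`, which explains the factor `2`. -/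
lemma sum_sq_tail_of_lt {α ι : Type*} [Fintype ι] [MeasurableSpace α] {Q : Measure α}
    [IsProbabilityMeasure Q] {f : α → ℝ} (hf : Measurable f) {R ε : ℝ}
    (h : orliczNorm 2 f Q < ENNReal.ofReal R) (hε : 0 ≤ ε) (hε1 : ε ≤ 1) :
    (Measure.pi fun _ : ι => Q).real
      {D | Fintype.card ι * (∫ z, f z ^ 2 ∂Q + 2 * ε * R ^ 2) < ∑ a, f (D a) ^ 2} ≤
      Real.exp (-(Fintype.card ι * ε ^ 2)) := by
  obtain ⟨r, hr, hrR, hi, hle⟩ := exists_exp_sq_integral_le hf h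
  set u : α → ℝ := fun z => f z ^ 2 / r ^ 2 with hu
  have hum : Measurable u := by fun_prop
  have hiu : Integrable u Q := integrable_sq_div_of_exp hf hi
  set E := ∫ z, u z ∂Q with hE
  have hE2 : ∫ z, f z ^ 2 ∂Q = r ^ 2 * E := by
    rw [hE, hu, integral_div]; field_simp
  have hu0 : ∀ z, 0 ≤ u z := fun z => by positivity
  have hE0 : 0 ≤ E := integral_nonneg hu0
  set B : α → ℝ := fun z => 1 + ε * u z + ε ^ 2 * (Real.exp (u z) - 1 - u z) with hB
  have hiB : Integrable B Q :=
    ((integrable_const 1).add (hiu.const_mul ε)).add ((hi.sub hiu).const_mul (ε ^ 2))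
  have hIB : ∫ z, B z ∂Q ≤ Real.exp (ε * E + ε ^ 2) := by
    have : ∫ z, B z ∂Q = 1 + ε * E + ε ^ 2 * (∫ z, (Real.exp (u z) - 1) ∂Q - E) := by
      have a1 : ∫ z, B z ∂Q = ∫ z, (1 + ε * u z) ∂Q +
          ∫ z, ε ^ 2 * (Real.exp (u z) - 1 - u z) ∂Q :=
        integral_add ((integrable_const 1).add (hiu.const_mul ε))
          ((hi.sub hiu).const_mul (ε ^ 2))
      have a2 : ∫ z, (1 + ε * u z) ∂Q = ∫ _, 1 ∂Q + ∫ z, ε * u z ∂Q :=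
        integral_add (integrable_const 1) (hiu.const_mul ε)
      have a3 : ∫ z, (Real.exp (u z) - 1 - u z) ∂Q = ∫ z, (Real.exp (u z) - 1) ∂Q - E :=
        integral_sub hi hiu
      rw [a1, a2, integral_const_mul, integral_const_mul, a3]
      simp [hE]
    rw [this]
    have h1 := Real.add_one_le_exp (ε * E + ε ^ 2)
    nlinarith [sq_nonneg ε]
  have hG : Measurable fun z => ε * u z - (ε * E + ε ^ 2) := by fun_prop
  have key := pi_sum_tail (ι := ι) hG (Q := Q) (by
    calc _ ≤ ∫⁻ z, ENNReal.ofReal (B z * Real.exp (-(ε * E + ε ^ 2))) ∂Q := by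
          refine lintegral_mono fun z => ENNReal.ofReal_le_ofReal ?_
          rw [sub_eq_add_neg, Real.exp_add]
          gcongr
          exact exp_mul_le hε hε1 (hu0 z)
      _ = ENNReal.ofReal (∫ z, B z * Real.exp (-(ε * E + ε ^ 2)) ∂Q) := by
          rw [ofReal_integral_eq_lintegral_ofReal (hiB.mul_const _)]
          refine Eventually.of_forall fun z => mul_nonneg ?_ (Real.exp_pos _).le
          have := exp_mul_le hε hε1 (hu0 z)
          exact (Real.exp_pos _).le.trans this
      _ ≤ 1 := by
          rw [integral_mul_const, ENNReal.ofReal_le_one]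
          calc _ ≤ Real.exp (ε * E + ε ^ 2) * Real.exp (-(ε * E + ε ^ 2)) := by gcongr
            _ = 1 := by rw [← Real.exp_add]; simp)
    (Fintype.card ι * ε ^ 2)
  refine (measureReal_mono ?_).trans key
  intro D hD
  simp only [Set.mem_ofPred_eq] at hD ⊢
  rw [Finset.sum_sub_distrib, Finset.sum_const, ← Finset.mul_sum, hu, ← Finset.sum_div,
    Finset.card_univ, nsmul_eq_mul]
  have hn : (0 : ℝ) ≤ Fintype.card ι := Nat.cast_nonneg _
  have h1 : Fintype.card ι * (E + 2 * ε) ≤ (∑ a, f (D a) ^ 2) / r ^ 2 := by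
    rw [le_div_iff₀ (by positivity)]
    refine le_trans ?_ hD.le
    rw [hE2, mul_assoc]
    refine mul_le_mul_of_nonneg_left ?_ hn
    have : ε * r ^ 2 ≤ ε * R ^ 2 := by gcongr
    nlinarith
  have h2 := mul_le_mul_of_nonneg_left h1 hε
  nlinarith

/-- An upper tail bound for sums of squares of sub-Gaussian variables. -/
lemma sum_sq_tail {α ι : Type*} [Fintype ι] [MeasurableSpace α] {Q : Measure α}
    [IsProbabilityMeasure Q] {f : α → ℝ} (hf : Measurable f) {σ ε : ℝ} (hσ : 0 ≤ σ)
    (h : orliczNorm 2 f Q ≤ ENNReal.ofReal σ) (hε : 0 ≤ ε) (hε1 : ε ≤ 1) :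
    (Measure.pi fun _ : ι => Q).real
      {D | Fintype.card ι * (∫ z, f z ^ 2 ∂Q + 2 * ε * σ ^ 2) < ∑ a, f (D a) ^ 2} ≤
      Real.exp (-(Fintype.card ι * ε ^ 2)) := by
  have hlim : Tendsto (fun n : ℕ => Fintype.card ι *
      (∫ z, f z ^ 2 ∂Q + 2 * ε * (σ + 1 / ((n : ℝ) + 1)) ^ 2)) atTop
      (𝓝 (Fintype.card ι * (∫ z, f z ^ 2 ∂Q + 2 * ε * σ ^ 2))) := by
    have h0 := (tendsto_one_div_add_atTop_nhds_zero_nat (𝕜 := ℝ)).const_add σ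
    rw [add_zero] at h0
    exact (((h0.pow 2).const_mul (2 * ε)).const_add _).const_mul _
  have := measureReal_lt_le_of_antitone (μ := Measure.pi fun _ : ι => Q) (A := Set.univ)
    (g := fun D => ∑ a, f (D a) ^ 2) (Real.exp_pos (-(Fintype.card ι * ε ^ 2))).le
    (fun m n hmn => ?_) hlim (fun n => ?_)
  · simpa using this
  · have : 1 / ((n : ℝ) + 1) ≤ 1 / ((m : ℝ) + 1) := by gcongr
    gcongr
  · simp only [Set.mem_univ, and_true]
    refine sum_sq_tail_of_lt hf (h.trans_lt ?_) hε hε1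
    have : 0 < 1 / ((n : ℝ) + 1) := by positivity
    exact (ENNReal.ofReal_lt_ofReal_iff (by positivity)).mpr (by linarith)

/-! ### The inverse-probability weights -/

lemma measurable_tCoord {p : ℕ} : Measurable (tCoord (p := p)) := measurable_fst

lemma measurable_observe {p : ℕ} : Measurable (observe (p := p)) := by
  unfold observe tCoord yCoord xCoord; fun_prop

lemma xCoord_mem_xSupport {p : ℕ} {P : Measure (Triple p)} :
    ∀ᵐ z ∂P, xCoord z ∈ xSupport P :=
  ae_of_ae_map measurable_xCoord.aemeasurable Measure.support_mem_ae

section Model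

variable {p : ℕ} {P : Measure (Triple p)} [IsProbabilityMeasure P]
  {prop m : (Fin p → ℝ) → ℝ} {δ : ℝ}

/-- The defining property of conditional probability says that `P` restricted to `E` and `P` with
density `g(X)` have the same image under `X`. Comparing image measures covers every nonnegative `F`,
with no integrability condition. -/
lemma setLIntegral_eq_of_condProb {E : Set (Triple p)} (hE : MeasurableSet E)
    {g : (Fin p → ℝ) → ℝ} (hg : Measurable g)
    (hgE : (fun z => g (xCoord z)) =ᵐ[P] P⟦E | xSigma p⟧)
    {F : (Fin p → ℝ) → ℝ≥0∞} (hF : Measurable F) :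
    ∫⁻ z in E, F (xCoord z) ∂P = ∫⁻ z, ENNReal.ofReal (g (xCoord z)) * F (xCoord z) ∂P := by
  have hx := measurable_xCoord (p := p)
  have hd : Measurable fun z : Triple p => ENNReal.ofReal (g (xCoord z)) :=
    (hg.comp hx).ennreal_ofReal
  have hi1 : Integrable (E.indicator fun _ => (1 : ℝ)) P := (integrable_const 1).indicator hE
  have hmeas : (P.restrict E).map xCoord =
      (P.withDensity fun z => ENNReal.ofReal (g (xCoord z))).map xCoord := by
    ext A hA
    rw [Measure.map_apply hx hA, Measure.map_apply hx hA, Measure.restrict_apply (hx hA),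
      withDensity_apply _ (hx hA), ← ofReal_integral_eq_lintegral_ofReal]
    · rw [setIntegral_congr_ae (g := P⟦E | xSigma p⟧) (hx hA) (hgE.mono fun z hz _ => hz),
        setIntegral_condExp measurable_xCoord.comap_le hi1 ⟨A, hA, rfl⟩,
        integral_indicator hE]
      simp [Measure.restrict_restrict hE, Set.inter_comm]
    · exact (integrable_condExp.congr hgE.symm).integrableOn
    · refine ae_restrict_of_ae ?_
      have h0 : 0 ≤ᵐ[P] P⟦E | xSigma p⟧ :=
        condExp_nonneg (Eventually.of_forall fun z => Set.indicator_nonneg (by simp) z)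
      filter_upwards [hgE, h0] with z h1 h2
      rw [h1]; exact h2
  calc _ = ∫⁻ x, F x ∂((P.restrict E).map xCoord) := (lintegral_map hF hx).symm
    _ = _ := by
      rw [hmeas, lintegral_map hF hx]
      exact lintegral_withDensity_eq_lintegral_mul P hd (hF.comp hx)

lemma IsMissingDataModel.prop_mem (H : IsMissingDataModel P prop m δ) :
    ∀ᵐ z ∂P, δ ≤ prop (xCoord z) ∧ prop (xCoord z) ≤ 1 := by
  have hE : MeasurableSet {z : Triple p | tCoord z = 1} :=
    measurable_tCoord (measurableSet_singleton 1)
  have hle : P⟦{z : Triple p | tCoord z = 1} | xSigma p⟧ ≤ᵐ[P] fun _ => (1 : ℝ) := by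
    have := condExp_mono (μ := P) (m := xSigma p)
      ((integrable_const (1 : ℝ)).indicator hE) (integrable_const (1 : ℝ))
      (Eventually.of_forall fun z => Set.indicator_le_self' (by simp) z)
    rwa [condExp_const measurable_xCoord.comap_le] at this
  filter_upwards [xCoord_mem_xSupport (P := P), H.propensity, hle] with z h1 h2 h3
  exact ⟨H.overlap _ h1, h2.trans_le h3⟩

/-- The exponential inequality for the centred inverse-probability weights. -/
lemma IsMissingDataModel.lintegral_exp_le (H : IsMissingDataModel P prop m δ) (hδ : 0 < δ)
    {u : (Fin p → ℝ) → ℝ} (hu : Measurable u) :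
    ∫⁻ z, ENNReal.ofReal (Real.exp ((tCoord z / prop (xCoord z) - 1) * u (xCoord z) -
      2 * barConst δ ^ 2 * u (xCoord z) ^ 2)) ∂(P.map observe) ≤ 1 := by
  have hp := H.measurable_prop
  have hx := measurable_xCoord (p := p)
  have ht := measurable_tCoord (p := p)
  set E := {z : Triple p | tCoord z = 1} with hEdef
  have hE : MeasurableSet E := ht (measurableSet_singleton 1)
  have hcompl : (fun z => 1 - prop (xCoord z)) =ᵐ[P] P⟦Eᶜ | xSigma p⟧ := by
    have h1 : (Eᶜ.indicator fun _ => (1 : ℝ)) =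
        (fun _ => (1 : ℝ)) - E.indicator fun _ => (1 : ℝ) := by
      rw [Set.indicator_compl]
    rw [h1]
    have h2 := condExp_sub (μ := P) (integrable_const (1 : ℝ))
      ((integrable_const (1 : ℝ)).indicator hE) (xSigma p)
    rw [condExp_const measurable_xCoord.comap_le] at h2
    filter_upwards [h2, H.propensity] with z h3 h4
    rw [h3, Pi.sub_apply, ← h4]
  set A : (Fin p → ℝ) → ℝ≥0∞ := fun x =>
    ENNReal.ofReal (Real.exp (u x * (1 / prop x - 1) - 2 * barConst δ ^ 2 * u x ^ 2)) with hA
  set B : (Fin p → ℝ) → ℝ≥0∞ := fun x =>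
    ENNReal.ofReal (Real.exp (-u x - 2 * barConst δ ^ 2 * u x ^ 2)) with hB
  have hAm : Measurable A := by fun_prop
  have hBm : Measurable B := by fun_prop
  -- On `T = 1` the weight is `1 / π(X) - 1`, on `T = 0` it is `-1`. Each piece becomes a function
  -- of `X` alone, and the two events can be replaced by their conditional probabilities.
  rw [lintegral_map (by fun_prop) measurable_observe, ← lintegral_add_compl _ hE]
  have h1 : ∫⁻ z in E, ENNReal.ofReal (Real.exp ((tCoord (observe z) /
      prop (xCoord (observe z)) - 1) * u (xCoord (observe z)) -
      2 * barConst δ ^ 2 * u (xCoord (observe z)) ^ 2)) ∂P = ∫⁻ z in E, A (xCoord z) ∂P := by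
    refine setLIntegral_congr_fun hE fun z hz => ?_
    have hz1 : tCoord z = 1 := hz
    change ENNReal.ofReal (Real.exp ((tCoord z / prop (xCoord z) - 1) * u (xCoord z) -
      2 * barConst δ ^ 2 * u (xCoord z) ^ 2)) = _
    rw [hz1, mul_comm]
  have h2 : ∫⁻ z in Eᶜ, ENNReal.ofReal (Real.exp ((tCoord (observe z) /
      prop (xCoord (observe z)) - 1) * u (xCoord (observe z)) -
      2 * barConst δ ^ 2 * u (xCoord (observe z)) ^ 2)) ∂P = ∫⁻ z in Eᶜ, B (xCoord z) ∂P := by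
    refine setLIntegral_congr_fun_ae hE.compl (H.binary.mono fun z hz hzE => ?_)
    have hz0 : tCoord z = 0 := hz.resolve_right hzE
    change ENNReal.ofReal (Real.exp ((tCoord z / prop (xCoord z) - 1) * u (xCoord z) -
      2 * barConst δ ^ 2 * u (xCoord z) ^ 2)) = _
    rw [hz0, zero_div, zero_sub, neg_one_mul]
  rw [h1, h2, setLIntegral_eq_of_condProb hE hp H.propensity hAm,
    setLIntegral_eq_of_condProb (g := fun x => 1 - prop x) hE.compl (by fun_prop) hcompl hBm,
    ← lintegral_add_left (by fun_prop)]
  calc _ ≤ ∫⁻ _, 1 ∂P := by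
        refine lintegral_mono_ae (H.prop_mem.mono fun z hz => ?_)
        have hw := weight_mgf_le hδ hz.1 hz.2 (u (xCoord z))
        have hπ : 0 ≤ prop (xCoord z) := hδ.le.trans hz.1
        have hπ1 : 0 ≤ 1 - prop (xCoord z) := sub_nonneg.mpr hz.2
        rw [hA, hB]
        dsimp only
        rw [← ENNReal.ofReal_mul hπ, ← ENNReal.ofReal_mul hπ1,
          ← ENNReal.ofReal_add (by positivity) (by positivity), ENNReal.ofReal_le_one,
          sub_eq_add_neg, sub_eq_add_neg (-u (xCoord z)), Real.exp_add, Real.exp_add]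
        calc _ = (prop (xCoord z) * Real.exp (u (xCoord z) * (1 / prop (xCoord z) - 1)) +
                (1 - prop (xCoord z)) * Real.exp (-u (xCoord z))) *
              Real.exp (-(2 * barConst δ ^ 2 * u (xCoord z) ^ 2)) := by ring
          _ ≤ Real.exp (2 * barConst δ ^ 2 * u (xCoord z) ^ 2) *
              Real.exp (-(2 * barConst δ ^ 2 * u (xCoord z) ^ 2)) := by gcongr
          _ = 1 := by rw [← Real.exp_add]; simp
    _ = 1 := by simp

lemma isProbabilityMeasure_map_observe : IsProbabilityMeasure (P.map observe) :=
  Measure.isProbabilityMeasure_map measurable_observe.aemeasurable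

/-- The random compensator stays inside the exponent, so the bound on `∑ u ^ 2` enters as an event
and no conditioning on the covariates is needed. -/
lemma IsMissingDataModel.weighted_sum_tail_of_pos (H : IsMissingDataModel P prop m δ) (hδ : 0 < δ)
    {u : (Fin p → ℝ) → ℝ} (hu : Measurable u) {K V r : ℝ} (hK : 0 < K)
    (hV : 2 * barConst δ ^ 2 * V ≤ K) (hr : 0 ≤ r) (N : ℕ) :
    (Measure.pi fun _ : Fin N => P.map observe).real
      {D | 2 * Real.sqrt (K * r) <
          ∑ a, (tCoord (D a) / prop (xCoord (D a)) - 1) * u (xCoord (D a)) ∧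
        D ∈ {D : Fin N → Triple p | ∑ a, u (xCoord (D a)) ^ 2 ≤ V}} ≤ Real.exp (-r) := by
  have := isProbabilityMeasure_map_observe (P := P)
  have hp := H.measurable_prop
  have hx := measurable_xCoord (p := p)
  have ht := measurable_tCoord (p := p)
  -- The optimal Chernoff parameter: at the threshold, `l * (2 √(K r)) - l ^ 2 * K = 2 r - r = r`.
  set l := Real.sqrt (r / K) with hl
  have hl0 : 0 ≤ l := Real.sqrt_nonneg _
  have hlK : l ^ 2 * K = r := by rw [hl, Real.sq_sqrt (by positivity)]; field_simp
  have hlr : l * Real.sqrt (K * r) = r := by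
    rw [hl, ← Real.sqrt_mul (by positivity), show r / K * (K * r) = r ^ 2 by field_simp,
      Real.sqrt_sq hr]
  have key := pi_sum_tail (ι := Fin N) (by fun_prop)
    (H.lintegral_exp_le hδ (u := fun x => l * u x) (by fun_prop)) r
  refine (measureReal_mono ?_).trans key
  rintro D ⟨h1, h2⟩
  simp only [Set.mem_ofPred_eq] at h1 h2 ⊢
  have e1 : ∑ a, ((tCoord (D a) / prop (xCoord (D a)) - 1) * (l * u (xCoord (D a))) -
      2 * barConst δ ^ 2 * (l * u (xCoord (D a))) ^ 2) =
      l * ∑ a, (tCoord (D a) / prop (xCoord (D a)) - 1) * u (xCoord (D a)) -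
      l ^ 2 * (2 * barConst δ ^ 2 * ∑ a, u (xCoord (D a)) ^ 2) := by
    rw [Finset.sum_sub_distrib, Finset.mul_sum, Finset.mul_sum, Finset.mul_sum]
    congr 1 <;> exact Finset.sum_congr rfl fun a _ => by ring
  rw [e1]
  have h3 := mul_le_mul_of_nonneg_left h1.le hl0
  have h4 : l ^ 2 * (2 * barConst δ ^ 2 * ∑ a, u (xCoord (D a)) ^ 2) ≤ l ^ 2 * K := by
    refine mul_le_mul_of_nonneg_left (le_trans ?_ hV) (sq_nonneg l)
    gcongr
  nlinarith

/-- A self-normalised tail bound for weighted sums. -/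
lemma IsMissingDataModel.weighted_sum_tail (H : IsMissingDataModel P prop m δ) (hδ : 0 < δ)
    {u : (Fin p → ℝ) → ℝ} (hu : Measurable u) {K V r : ℝ} (hK : 0 ≤ K)
    (hV : 2 * barConst δ ^ 2 * V ≤ K) (hr : 0 ≤ r) (N : ℕ) :
    (Measure.pi fun _ : Fin N => P.map observe).real
      {D | 2 * Real.sqrt (K * r) <
          ∑ a, (tCoord (D a) / prop (xCoord (D a)) - 1) * u (xCoord (D a)) ∧
        D ∈ {D : Fin N → Triple p | ∑ a, u (xCoord (D a)) ^ 2 ≤ V}} ≤ Real.exp (-r) := by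
  have := isProbabilityMeasure_map_observe (P := P)
  -- The parameter `√(r / K)` needs `K > 0`; the case `K = 0` is reached by letting `K + 1 / (n +
  -- 1)` decrease to `K`.
  refine measureReal_lt_le_of_antitone (c := fun n : ℕ =>
    2 * Real.sqrt ((K + 1 / ((n : ℝ) + 1)) * r)) (Real.exp_pos _).le (fun i j hij => ?_) ?_
    fun n => ?_
  · have : 1 / ((j : ℝ) + 1) ≤ 1 / ((i : ℝ) + 1) := by gcongr
    dsimp only
    gcongr
  · have h0 := (tendsto_one_div_add_atTop_nhds_zero_nat (𝕜 := ℝ)).const_add K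
    rw [add_zero] at h0
    exact ((h0.mul_const r).sqrt).const_mul 2
  · have : 0 < 1 / ((n : ℝ) + 1) := by positivity
    exact H.weighted_sum_tail_of_pos hδ hu (by linarith) (by linarith) hr N

end Model

/-! ### One fold, given the estimate computed on the other -/

/-- The unnormalised error over a fold `D.1`, with the estimate computed on `D.2`. -/
noncomputable def foldError {N p d : ℕ} (prop m : (Fin p → ℝ) → ℝ) (h : (Fin p → ℝ) → Fin d → ℝ)
    (mhat : (Fin N → Triple p) → (Fin p → ℝ) → ℝ) (j : Fin d)
    (D : (Fin N → Triple p) × (Fin N → Triple p)) : ℝ :=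
  ∑ a, (tCoord (D.1 a) / prop (xCoord (D.1 a)) - 1) *
    (mhat D.2 (xCoord (D.1 a)) - m (xCoord (D.1 a))) * h (xCoord (D.1 a)) j

lemma measurable_foldError {N p d : ℕ} {prop m : (Fin p → ℝ) → ℝ} {h : (Fin p → ℝ) → Fin d → ℝ}
    {mhat : (Fin N → Triple p) → (Fin p → ℝ) → ℝ} (hprop : Measurable prop) (hm : Measurable m)
    (hh : Measurable h) (hmhat : Measurable (Function.uncurry mhat)) (j : Fin d) :
    Measurable (foldError prop m h mhat j) := by
  have hx := measurable_xCoord (p := p)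
  have ht := measurable_tCoord (p := p)
  refine Finset.measurable_sum _ fun a _ => ?_
  have h1 : Measurable fun D : (Fin N → Triple p) × (Fin N → Triple p) => xCoord (D.1 a) := by
    fun_prop
  have h2 : Measurable fun D : (Fin N → Triple p) × (Fin N → Triple p) =>
      mhat D.2 (xCoord (D.1 a)) := hmhat.comp (measurable_snd.prodMk h1)
  fun_prop

/-- The estimation error, set to zero where it exceeds `τ`. -/
noncomputable def truncError {N p : ℕ} (m : (Fin p → ℝ) → ℝ) (mhat : (Fin N → Triple p) → (Fin p → ℝ) → ℝ)
    (τ : ℝ) (D : Fin N → Triple p) (x : Fin p → ℝ) : ℝ :=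
  if |mhat D x - m x| ≤ τ then mhat D x - m x else 0

lemma measurable_truncError {N p : ℕ} {m : (Fin p → ℝ) → ℝ}
    {mhat : (Fin N → Triple p) → (Fin p → ℝ) → ℝ} (hm : Measurable m)
    (hmhat : Measurable (Function.uncurry mhat)) (τ : ℝ) :
    Measurable (Function.uncurry (truncError m mhat τ)) := by
  have h1 : Measurable fun y : (Fin N → Triple p) × (Fin p → ℝ) => mhat y.1 y.2 - m y.2 :=
    hmhat.sub (hm.comp measurable_snd)
  exact Measurable.ite (measurableSet_le h1.abs measurable_const) h1 measurable_const

lemma integral_map_observe {p : ℕ} {P : Measure (Triple p)} {f : (Fin p → ℝ) → ℝ} (hf : Measurable f) :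
    ∫ z, f (xCoord z) ∂(P.map observe) = ∫ z, f (xCoord z) ∂P :=
  integral_map measurable_observe.aemeasurable
    (hf.comp measurable_xCoord).aestronglyMeasurable

lemma orliczNorm_map_observe {p : ℕ} {P : Measure (Triple p)} {f : (Fin p → ℝ) → ℝ} (hf : Measurable f) (α : ℝ) :
    orliczNorm α (fun z => f (xCoord z)) (P.map observe) =
      orliczNorm α (fun z => f (xCoord z)) P := by
  have hx := measurable_xCoord (p := p)
  unfold orliczNorm
  congr! 7 with c r
  rw [lintegral_map (by fun_prop) measurable_observe]
  rfl

lemma integral_sq_le_maxSecondMoment {p : ℕ} {P : Measure (Triple p)} {d : ℕ} (h : (Fin p → ℝ) → Fin d → ℝ) (j : Fin d) :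
    ∫ z, h (xCoord z) j ^ 2 ∂P ≤ maxSecondMoment P h :=
  le_ciSup (f := fun j => ∫ z, h (xCoord z) j ^ 2 ∂P) (Set.finite_range _).bddAbove j

lemma maxSecondMoment_nonneg {p : ℕ} {P : Measure (Triple p)} {d : ℕ} (h : (Fin p → ℝ) → Fin d → ℝ) :
    0 ≤ maxSecondMoment P h :=
  Real.iSup_nonneg fun _ => integral_nonneg fun _ => sq_nonneg _

section Model

variable {p : ℕ} {P : Measure (Triple p)} [IsProbabilityMeasure P]
  {prop m : (Fin p → ℝ) → ℝ} {δ : ℝ}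

/-- On one fold, the estimation error is uniformly controlled. -/
lemma estimation_error_tail {N : ℕ} (hm : Measurable m)
    {mhat : (Fin N → Triple p) → (Fin p → ℝ) → ℝ} (hmhat : Measurable (Function.uncurry mhat))
    {C v q t : ℝ} (hC : 0 ≤ C) (hq : 0 ≤ q) (htail : HasPointwiseTail P m mhat C v q)
    (ht : 0 ≤ t) (a : Fin N) :
    ((Measure.pi fun _ : Fin N => P.map observe).prod
      (Measure.pi fun _ : Fin N => P.map observe)).real
      {D | t * v < |mhat D.2 (xCoord (D.1 a)) - m (xCoord (D.1 a))|} ≤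
      C * Real.exp (-t ^ 2) + q := by
  have := isProbabilityMeasure_map_observe (P := P)
  have hx := measurable_xCoord (p := p)
  have h1 : Measurable fun D : (Fin N → Triple p) × (Fin N → Triple p) => xCoord (D.1 a) := by
    fun_prop
  have h2 : Measurable fun D : (Fin N → Triple p) × (Fin N → Triple p) =>
      mhat D.2 (xCoord (D.1 a)) := hmhat.comp (measurable_snd.prodMk h1)
  refine prod_real_le_of_left (measurableSet_lt measurable_const (by fun_prop)) (by positivity) ?_
  have hQ : ∀ᵐ z ∂(P.map observe), xCoord z ∈ xSupport P := by
    have h3 : (P.map observe).map xCoord = P.map xCoord := by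
      rw [Measure.map_map hx measurable_observe]; rfl
    refine ae_of_ae_map hx.aemeasurable ?_
    rw [h3]
    exact Measure.support_mem_ae
  -- Almost every frozen covariate lies in the support, where the pointwise tail applies to the
  -- independent fold `D.2`.
  have hpi := (measurePreserving_eval (fun _ : Fin N => P.map observe) a).quasiMeasurePreserving.ae
    hQ
  filter_upwards [hpi] with D hD
  exact htail _ hD t ht

/-- The tail bound for the error over one fold. -/
lemma IsMissingDataModel.foldError_tail (H : IsMissingDataModel P prop m δ) (hδ : 0 < δ)
    {N d : ℕ} {h : (Fin p → ℝ) → Fin d → ℝ} (hh : Measurable h) {σ : ℝ} (hσ : 0 ≤ σ)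
    (hsubG : orliczNormVec 2 (fun z => h (xCoord z)) P ≤ ENNReal.ofReal σ)
    {mhat : (Fin N → Triple p) → (Fin p → ℝ) → ℝ} (hmhat : Measurable (Function.uncurry mhat))
    {C v q t ε r : ℝ} (hC : 0 ≤ C) (hq : 0 ≤ q)
    (htail : HasPointwiseTail P m mhat C v q)
    (ht : 0 ≤ t) (hε : 0 ≤ ε) (hε1 : ε ≤ 1) (hr : 0 ≤ r) :
    ((Measure.pi fun _ : Fin N => P.map observe).prod
      (Measure.pi fun _ : Fin N => P.map observe)).real
      {D | ∃ j, 2 * Real.sqrt (2 * barConst δ ^ 2 *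
        ((t * v) ^ 2 * (N * (maxSecondMoment P h + 2 * ε * σ ^ 2))) * r) <
          |foldError prop m h mhat j D|} ≤
      N * (C * Real.exp (-t ^ 2) + q) + d * Real.exp (-(N * ε ^ 2)) + 2 * d * Real.exp (-r) := by
  have := isProbabilityMeasure_map_observe (P := P)
  have hx := measurable_xCoord (p := p)
  have htc := measurable_tCoord (p := p)
  have hprop := H.measurable_prop
  have hm := H.measurable_regression
  have hM := maxSecondMoment_nonneg (P := P) h
  set W := maxSecondMoment P h + 2 * ε * σ ^ 2 with hW
  have hW0 : 0 ≤ W := by positivity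
  set V := (t * v) ^ 2 * (N * W) with hV
  set s := 2 * Real.sqrt (2 * barConst δ ^ 2 * V * r) with hs
  set ρ := (Measure.pi fun _ : Fin N => P.map observe) with hρ
  let g := truncError m mhat (t * v)
  have hg : Measurable (Function.uncurry g) := measurable_truncError hm hmhat _
  -- The bad events: `A₁`, a large estimation error at one covariate; `A₂`, a large empirical second
  -- moment of one coordinate of `h`; `A₃`, a large sum of sign `e = ±1` despite a controlled sum of
  -- squares. Off all `A₁` the truncated error `g` equals the estimation error, and off `A₂` as well
  -- the sum of squares is at most `V`.
  let A₁ : Fin N → Set ((Fin N → Triple p) × (Fin N → Triple p)) := fun a =>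
    {D | t * v < |mhat D.2 (xCoord (D.1 a)) - m (xCoord (D.1 a))|}
  let A₂ : Fin d → Set ((Fin N → Triple p) × (Fin N → Triple p)) := fun j =>
    {D | N * W < ∑ a, h (xCoord (D.1 a)) j ^ 2}
  let A₃ : ℝ → Fin d → Set ((Fin N → Triple p) × (Fin N → Triple p)) := fun e j =>
    {D | s < ∑ a, (tCoord (D.1 a) / prop (xCoord (D.1 a)) - 1) *
        (e * g D.2 (xCoord (D.1 a)) * h (xCoord (D.1 a)) j) ∧
      ∑ a, (e * g D.2 (xCoord (D.1 a)) * h (xCoord (D.1 a)) j) ^ 2 ≤ V}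
  have hA₁ : ∀ a, (ρ.prod ρ).real (A₁ a) ≤ C * Real.exp (-t ^ 2) + q := fun a =>
    estimation_error_tail hm hmhat hC hq htail ht a
  have hA₂ : ∀ j, (ρ.prod ρ).real (A₂ j) ≤ Real.exp (-(N * ε ^ 2)) := by
    intro j
    have hhj : Measurable fun x => h x j := (measurable_pi_apply j).comp hh
    refine prod_real_le_of_right (measurableSet_lt measurable_const (by fun_prop))
      (Real.exp_pos _).le (Eventually.of_forall fun D => ?_)
    have key := sum_sq_tail (ι := Fin N) (Q := P.map observe) (f := fun z => h (xCoord z) j)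
      (by fun_prop) hσ
      ((orliczNorm_map_observe hhj 2).trans_le ((le_iSup (fun j => orliczNorm 2
        (fun z => h (xCoord z) j) P) j).trans hsubG)) hε hε1
    rw [integral_map_observe (f := fun x => h x j ^ 2) (by fun_prop), Fintype.card_fin] at key
    refine (measureReal_mono fun D' hD' => ?_).trans key
    refine lt_of_le_of_lt ?_ (show N * W < ∑ a, h (xCoord (D' a)) j ^ 2 from hD')
    rw [hW]
    gcongr
    exact integral_sq_le_maxSecondMoment h j
  have hA₃ : ∀ e j, (ρ.prod ρ).real (A₃ e j) ≤ Real.exp (-r) := by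
    intro e j
    have hhj : Measurable fun x => h x j := (measurable_pi_apply j).comp hh
    have h2 : ∀ a, Measurable fun D : (Fin N → Triple p) × (Fin N → Triple p) =>
        g D.2 (xCoord (D.1 a)) := fun a => hg.comp (measurable_snd.prodMk
          (hx.comp ((measurable_pi_apply a).comp measurable_fst)))
    have hA : MeasurableSet (A₃ e j) := by
      have h4 : Measurable fun D : (Fin N → Triple p) × (Fin N → Triple p) =>
          ∑ a, (tCoord (D.1 a) / prop (xCoord (D.1 a)) - 1) *
            (e * g D.2 (xCoord (D.1 a)) * h (xCoord (D.1 a)) j) := by fun_prop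
      have h5 : Measurable fun D : (Fin N → Triple p) × (Fin N → Triple p) =>
          ∑ a, (e * g D.2 (xCoord (D.1 a)) * h (xCoord (D.1 a)) j) ^ 2 := by fun_prop
      exact (measurableSet_lt measurable_const h4).inter (measurableSet_le h5 measurable_const)
    refine prod_real_le_of_right hA (Real.exp_pos _).le (Eventually.of_forall fun D => ?_)
    have h3 : Measurable (g D) := hg.comp measurable_prodMk_left
    exact H.weighted_sum_tail hδ (u := fun x => e * g D x * h x j) (by fun_prop)
      (K := 2 * barConst δ ^ 2 * V) (V := V) (by positivity) le_rfl hr N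
  have hsub : {D | ∃ j, s < |foldError prop m h mhat j D|} ⊆
      (⋃ a, A₁ a) ∪ (⋃ j, A₂ j) ∪ ((⋃ j, A₃ 1 j) ∪ ⋃ j, A₃ (-1) j) := by
    rintro D ⟨j, hj⟩
    by_contra hD
    simp only [Set.mem_union, Set.mem_iUnion, not_or, not_exists] at hD
    obtain ⟨⟨h1, h2⟩, h3, h4⟩ := hD
    have h1' : ∀ a, g D.2 (xCoord (D.1 a)) = mhat D.2 (xCoord (D.1 a)) - m (xCoord (D.1 a)) :=
      fun a => if_pos (not_lt.mp (h1 a))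
    have hVj : ∀ e : ℝ, e ^ 2 = 1 →
        ∑ a, (e * g D.2 (xCoord (D.1 a)) * h (xCoord (D.1 a)) j) ^ 2 ≤ V := by
      intro e he
      calc _ ≤ ∑ a, (t * v) ^ 2 * h (xCoord (D.1 a)) j ^ 2 := by
            refine Finset.sum_le_sum fun a _ => ?_
            rw [mul_pow, mul_pow, he, one_mul, h1' a]
            refine mul_le_mul_of_nonneg_right ?_ (sq_nonneg _)
            exact sq_le_sq' (abs_le.mp (not_lt.mp (h1 a))).1 (abs_le.mp (not_lt.mp (h1 a))).2
        _ = (t * v) ^ 2 * ∑ a, h (xCoord (D.1 a)) j ^ 2 := (Finset.mul_sum _ _ _).symm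
        _ ≤ V := mul_le_mul_of_nonneg_left (not_lt.mp (h2 j)) (sq_nonneg _)
    have hS : ∀ e : ℝ, ∑ a, (tCoord (D.1 a) / prop (xCoord (D.1 a)) - 1) *
        (e * g D.2 (xCoord (D.1 a)) * h (xCoord (D.1 a)) j) = e * foldError prop m h mhat j D := by
      intro e
      rw [foldError, Finset.mul_sum]
      exact Finset.sum_congr rfl fun a _ => by rw [h1' a]; ring
    rcases lt_abs.mp hj with hj | hj
    · exact h3 j ⟨by rw [hS, one_mul]; exact hj, hVj 1 (by norm_num)⟩
    · exact h4 j ⟨by rw [hS, neg_one_mul]; exact hj, hVj (-1) (by norm_num)⟩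
  have hsum : ∀ {n : ℕ} (A : Fin n → Set ((Fin N → Triple p) × (Fin N → Triple p))) {b : ℝ},
      (∀ i, (ρ.prod ρ).real (A i) ≤ b) → (ρ.prod ρ).real (⋃ i, A i) ≤ n * b := by
    intro n A b hA
    refine (measureReal_iUnion_fintype_le A).trans ((Finset.sum_le_sum fun i _ => hA i).trans ?_)
    simp
  calc _ ≤ _ := measureReal_mono hsub
    _ ≤ ((ρ.prod ρ).real (⋃ a, A₁ a) + (ρ.prod ρ).real (⋃ j, A₂ j)) +
        ((ρ.prod ρ).real (⋃ j, A₃ 1 j) + (ρ.prod ρ).real (⋃ j, A₃ (-1) j)) :=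
      (measureReal_union_le _ _).trans
        (add_le_add (measureReal_union_le _ _) (measureReal_union_le _ _))
    _ ≤ _ := by
      have := hsum A₁ hA₁
      have := hsum A₂ hA₂
      have := hsum _ (hA₃ 1)
      have := hsum _ (hA₃ (-1))
      linarith

end Model

/-! ### Random splits -/

/-- The increasing enumeration of a fold. -/
noncomputable def foldIdx {N : ℕ} (s : Split N) (k : Fin 2) (a : Fin N) : Fin (2 * N) :=
  (Finset.univ.filter (fun i => s.1 i = k)).orderEmbOfFin (s.2 k) a

lemma foldIdx_label {N : ℕ} (s : Split N) (k : Fin 2) (a : Fin N) : s.1 (foldIdx s k a) = k :=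
  (Finset.mem_filter.mp (Finset.orderEmbOfFin_mem _ (s.2 k) a)).2

/-- Each enumeration is injective, the labels keep the two ranges disjoint, and the cardinalities `N
+ N` and `2 * N` agree. -/
lemma foldIdx_bijective {N : ℕ} (s : Split N) (k : Fin 2) :
    Function.Bijective (Sum.elim (foldIdx s k) (foldIdx s (Fin.rev k))) := by
  refine (Fintype.bijective_iff_injective_and_card _).mpr
    ⟨Function.Injective.sumElim ?_ ?_ fun a b hab => ?_, by simp [two_mul]⟩
  · exact (Finset.orderEmbOfFin _ (s.2 k)).injective
  · exact (Finset.orderEmbOfFin _ (s.2 (Fin.rev k))).injective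
  · have := congrArg s.1 hab
    rw [foldIdx_label, foldIdx_label] at this
    revert this
    fin_cases k <;> decide

/-- The indices of a fold followed by those of the other fold. -/
noncomputable def foldEquiv {N : ℕ} (s : Split N) (k : Fin 2) : Fin N ⊕ Fin N ≃ Fin (2 * N) :=
  Equiv.ofBijective _ (foldIdx_bijective s k)

/-- For a fixed split the folds are two independent i.i.d. samples of size `N`; this is the
independence behind cross-fitting. -/
lemma measurePreserving_subsample {N p : ℕ} (Q : Measure (Triple p)) [IsProbabilityMeasure Q]
    (s : Split N) (k : Fin 2) :
    MeasurePreserving (fun z => (subsample s k z, subsample s (Fin.rev k) z))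
      (Measure.pi fun _ => Q) ((Measure.pi fun _ => Q).prod (Measure.pi fun _ => Q)) :=
  measurePreserving_split Q (foldEquiv s k)

lemma errorTerm_eq_foldError {N p d : ℕ} (prop m : (Fin p → ℝ) → ℝ) (h : (Fin p → ℝ) → Fin d → ℝ)
    (mhat : (Fin N → Triple p) → (Fin p → ℝ) → ℝ) (s : Split N) (z : Fin (2 * N) → Triple p)
    (j : Fin d) : errorTerm prop m h mhat s z j = ((2 * N : ℕ) : ℝ)⁻¹ *
      (foldError prop m h mhat j (subsample s 0 z, subsample s 1 z) +
        foldError prop m h mhat j (subsample s 1 z, subsample s 0 z)) := by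
  rw [errorTerm, ← (foldEquiv s 0).sum_comp, Fintype.sum_sum_type]
  congr 2
  · refine Finset.sum_congr rfl fun a _ => ?_
    change _ * (mhat (subsample s (Fin.rev (s.1 (foldIdx s 0 a))) z) _ - _) * _ = _
    rw [foldIdx_label]; rfl
  · refine Finset.sum_congr rfl fun a _ => ?_
    change _ * (mhat (subsample s (Fin.rev (s.1 (foldIdx s 1 a))) z) _ - _) * _ = _
    rw [foldIdx_label]; rfl

/-- The two fold errors would otherwise add up to at most `2 * N * B` in every coordinate, which the
normalisation turns into `B`. -/
lemma exists_foldError_lt {N p d : ℕ} (hN : 1 ≤ N) {prop m : (Fin p → ℝ) → ℝ}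
    {h : (Fin p → ℝ) → Fin d → ℝ} {mhat : (Fin N → Triple p) → (Fin p → ℝ) → ℝ} {s : Split N}
    {z : Fin (2 * N) → Triple p} {B : ℝ} (hB : 0 ≤ B) (hz : B < ‖errorTerm prop m h mhat s z‖) :
    ∃ k j, N * B < |foldError prop m h mhat j (subsample s k z, subsample s (Fin.rev k) z)| := by
  by_contra! hcon
  refine hz.not_ge ((pi_norm_le_iff_of_nonneg hB).mpr fun j => ?_)
  have hN0 : (0 : ℝ) < N := by exact_mod_cast hN
  rw [errorTerm_eq_foldError, Real.norm_eq_abs, abs_mul, abs_of_nonneg (by positivity),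
    inv_mul_le_iff₀ (by positivity)]
  have h0 := hcon 0 j
  have h1 := hcon 1 j
  refine (abs_add_le _ _).trans ((add_le_add h0 h1).trans_eq ?_)
  push_cast; ring

/-- Independence of split and data allows the split to be frozen, so a bound uniform over
deterministic splits suffices, whatever the law of `S`. -/
lemma IsSplitSample.real_le {Ω : Type*} [MeasurableSpace Ω] {N p : ℕ} {μ : Measure Ω}
    [IsProbabilityMeasure μ] {P : Measure (Triple p)} [IsProbabilityMeasure P]
    {Z : Fin (2 * N) → Ω → Triple p} {S : Ω → Split N} (H : IsSplitSample μ P Z S)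
    {A : Split N → Set (Fin (2 * N) → Triple p)} (hA : ∀ s, MeasurableSet (A s)) {b : ℝ}
    (hb : 0 ≤ b) (hAb : ∀ s, (Measure.pi fun _ => P.map observe).real (A s) ≤ b) :
    μ.real {ω | (fun i => Z i ω) ∈ A (S ω)} ≤ b := by
  have := isProbabilityMeasure_map_observe (P := P)
  have hZ : Measurable fun ω i => Z i ω := measurable_pi_lambda _ H.measurable_obs
  have hlaw : μ.map (fun ω i => Z i ω) = Measure.pi fun _ => P.map observe := by
    rw [(iIndepFun_iff_map_fun_eq_pi_map fun i => (H.measurable_obs i).aemeasurable).mp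
      H.indep_obs]
    congr 1; ext1 i; exact H.law_obs i
  have hjoint := (indepFun_iff_map_prod_eq_prod_map_map H.measurable_split.aemeasurable
    hZ.aemeasurable).mp H.indep_split
  rw [hlaw] at hjoint
  have hSp : IsProbabilityMeasure (μ.map S) :=
    Measure.isProbabilityMeasure_map H.measurable_split.aemeasurable
  have hmeas : MeasurableSet {y : Split N × (Fin (2 * N) → Triple p) | y.2 ∈ A y.1} := by
    have : {y : Split N × (Fin (2 * N) → Triple p) | y.2 ∈ A y.1} = ⋃ s, {s} ×ˢ A s := by
      ext ⟨s, z⟩; simp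
    rw [this]
    exact MeasurableSet.iUnion fun s => (measurableSet_singleton s).prod (hA s)
  have key := prod_real_le_of_left (μ := μ.map S) hmeas hb (Eventually.of_forall hAb)
  rw [← hjoint, map_measureReal_apply (H.measurable_split.prodMk hZ) hmeas] at key
  exact key

/-! ### The finite-sample bound -/

/-- This rewrites the correction term through `ε = c₂ √(l / N)`, the deviation parameter of the
second-moment bound, which itself only needs `2 ε σ ^ 2`. -/
lemma C2star_mul_sqrt (c₂ σ l : ℝ) (N : ℕ) :
    C2star c₂ σ * Real.sqrt (l / (2 * N)) = 6 * (c₂ * Real.sqrt (l / N)) * σ ^ 2 := by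
  have h2 : Real.sqrt 2 * Real.sqrt 2 = 2 := Real.mul_self_sqrt zero_le_two
  have h3 : Real.sqrt (l / N) = Real.sqrt 2 * Real.sqrt (l / (2 * N)) := by
    rw [← Real.sqrt_mul zero_le_two]
    congr 1
    rw [← mul_div_assoc, mul_div_mul_left _ _ two_ne_zero]
  rw [h3, C2star]
  linear_combination (2 * Real.sqrt 2 * c₂ * σ ^ 2 * Real.sqrt (l / (2 * N))) * h2

lemma C1star_nonneg {c₁ δ : ℝ} (hc₁ : 0 ≤ c₁) (hδ : 0 < δ) : 0 ≤ C1star c₁ δ :=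
  mul_nonneg (by positivity) (barConst_nonneg hδ)

lemma rateBound_nonneg {c c₁ c₂ δ σ M v : ℝ} {N d : ℕ} (hc : 0 ≤ c) (hc₁ : 0 ≤ c₁) (hδ : 0 < δ)
    (hv : 0 ≤ v) : 0 ≤ rateBound c c₁ c₂ δ σ M v N d := by
  have := C1star_nonneg hc₁ hδ
  unfold rateBound
  positivity

/-- After squaring, the numerical factors on both sides coincide; the only slack is `log (N d) ≤ log
(2 N d)` and `2 ε σ ^ 2 ≤ 6 ε σ ^ 2`. -/
lemma sqrt_le_mul_rateBound {c c₁ c₂ δ σ M v : ℝ} {N d : ℕ} (hN : 1 ≤ N) (hd : 2 ≤ d)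
    (hc : 0 ≤ c) (hc₁ : 0 ≤ c₁) (hc₂ : 0 ≤ c₂) (hδ : 0 < δ) (hM : 0 ≤ M) (hv : 0 ≤ v) :
    2 * Real.sqrt (2 * barConst δ ^ 2 * ((c₁ * Real.sqrt (Real.log (N * d)) * v) ^ 2 *
      (N * (M + 2 * (c₂ * Real.sqrt (Real.log d / N)) * σ ^ 2))) * (c ^ 2 * Real.log d)) ≤
      N * rateBound c c₁ c₂ δ σ M v N d := by
  have hN1 : (1 : ℝ) ≤ N := by exact_mod_cast hN
  have hd2 : (2 : ℝ) ≤ d := by exact_mod_cast hd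
  have hld : 0 ≤ Real.log d := Real.log_nonneg (by linarith)
  have hNd : (1 : ℝ) ≤ N * d := by nlinarith
  have hl1 : 0 ≤ Real.log (N * d) := Real.log_nonneg hNd
  have hl2 : Real.log (N * d) ≤ Real.log (2 * N * d) :=
    Real.log_le_log (by linarith) (by nlinarith)
  have hB := rateBound_nonneg (c₂ := c₂) (σ := σ) (M := M) (N := N) (d := d) hc hc₁ hδ hv
  set ε := c₂ * Real.sqrt (Real.log d / N) with hε
  have hε0 : 0 ≤ ε := by positivity
  rw [← le_div_iff₀' two_pos, Real.sqrt_le_iff]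
  refine ⟨by positivity, ?_⟩
  rw [rateBound, C2star_mul_sqrt, ← hε, C1star]
  simp only [div_pow, mul_pow]
  rw [Real.sq_sqrt hl1, Real.sq_sqrt (by positivity), Real.sq_sqrt (hl1.trans hl2),
    Real.sq_sqrt (by positivity)]
  have hW : M + 2 * ε * σ ^ 2 ≤ M + 6 * ε * σ ^ 2 := by nlinarith [mul_nonneg hε0 (sq_nonneg σ)]
  have hW0 : 0 ≤ M + 2 * ε * σ ^ 2 := by positivity
  calc _ = 2 * barConst δ ^ 2 * c₁ ^ 2 * v ^ 2 * N * c ^ 2 * Real.log d *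
        (Real.log (N * d) * (M + 2 * ε * σ ^ 2)) := by ring
    _ ≤ 2 * barConst δ ^ 2 * c₁ ^ 2 * v ^ 2 * N * c ^ 2 * Real.log d *
        (Real.log (2 * N * d) * (M + 6 * ε * σ ^ 2)) := by gcongr; exact hl1.trans hl2
    _ = _ := by field_simp; ring

/-- The finite-sample tail bound for the error term. -/
theorem errorTerm_tail {p d N : ℕ} {δ σ C v q c c₁ c₂ : ℝ} (hδ : 0 < δ) (hσ : 0 ≤ σ) (hC : 0 < C)
    (hd : 2 ≤ d) (hN : 1 ≤ N) (hv : 0 ≤ v) (hq : 0 ≤ q)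
    {P : Measure (Triple p)} [IsProbabilityMeasure P] {prop m : (Fin p → ℝ) → ℝ}
    (H : IsMissingDataModel P prop m δ) {h : (Fin p → ℝ) → Fin d → ℝ} (hh : Measurable h)
    (hsubG : orliczNormVec 2 (fun z => h (xCoord z)) P ≤ ENNReal.ofReal σ)
    {mhat : (Fin N → Triple p) → (Fin p → ℝ) → ℝ} (hmhat : Measurable (Function.uncurry mhat))
    (htail : HasPointwiseTail P m mhat C v q)
    {Ω : Type*} [MeasurableSpace Ω] {μ : Measure Ω} [IsProbabilityMeasure μ]
    {Z : Fin (2 * N) → Ω → Triple p} {S : Ω → Split N} (hsample : IsSplitSample μ P Z S)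
    (hc : 1 < c) (hc₁ : 1 < c₁) (hc₂ : 1 < c₂) (hlt : c₂ * Real.sqrt (Real.log d / N) < 1) :
    μ.real {ω | rateBound c c₁ c₂ δ σ (maxSecondMoment P h) v N d <
        ‖errorTerm prop m h mhat (S ω) (fun i => Z i ω)‖} ≤
      4 * (d : ℝ) ^ (-(c ^ 2 - 1)) + 8 * (d : ℝ) ^ (-(c₂ ^ 2 - 1)) +
        4 * C * ((N : ℝ) * d) ^ (-(c₁ ^ 2 - 1)) + 4 * q * (N * d) := by
  have := isProbabilityMeasure_map_observe (P := P)
  have hN1 : (1 : ℝ) ≤ N := by exact_mod_cast hN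
  have hd2 : (2 : ℝ) ≤ d := by exact_mod_cast hd
  have hd0 : (0 : ℝ) < d := by linarith
  have hld : 0 ≤ Real.log d := Real.log_nonneg (by linarith)
  have hNd : (1 : ℝ) ≤ N * d := by nlinarith
  have hNd0 : (0 : ℝ) < N * d := by linarith
  have hl1 : 0 ≤ Real.log (N * d) := Real.log_nonneg hNd
  set ε := c₂ * Real.sqrt (Real.log d / N) with hε
  have hε0 : 0 ≤ ε := by positivity
  set B := rateBound c c₁ c₂ δ σ (maxSecondMoment P h) v N d with hB
  have hB0 : 0 ≤ B := rateBound_nonneg (by linarith) (by linarith) hδ hv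
  set F : Set ((Fin N → Triple p) × (Fin N → Triple p)) :=
    {D | ∃ j, N * B < |foldError prop m h mhat j D|} with hF
  have hFm : MeasurableSet F := by
    have : F = ⋃ j, {D | N * B < |foldError prop m h mhat j D|} := by ext; simp [hF]
    rw [this]
    exact MeasurableSet.iUnion fun j => measurableSet_lt measurable_const
      (measurable_foldError H.measurable_prop H.measurable_regression hh hmhat j).abs
  -- The prefactor left by a union bound over `a` events costs one power of `a`, whence the
  -- exponents `y ^ 2 - 1`.
  have hpow : ∀ {a y : ℝ}, 0 < a → a * Real.exp (-(y ^ 2 * Real.log a)) = a ^ (-(y ^ 2 - 1)) := by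
    intro a y ha
    rw [Real.rpow_def_of_pos ha]
    nth_rewrite 1 [← Real.exp_log ha]
    rw [← Real.exp_add]
    ring_nf
  have hFb : ((Measure.pi fun _ : Fin N => P.map observe).prod
      (Measure.pi fun _ : Fin N => P.map observe)).real F ≤
      2 * (d : ℝ) ^ (-(c ^ 2 - 1)) + 4 * (d : ℝ) ^ (-(c₂ ^ 2 - 1)) +
        2 * C * ((N : ℝ) * d) ^ (-(c₁ ^ 2 - 1)) + 2 * q * (N * d) := by
    -- The levels `r = c² log d`, `t = c₁ √(log (N d))` and `ε = c₂ √(log d / N)` beat the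
    -- respective unions over `d`, `N` and `d` events. The assumption on `c₂` is exactly `ε < 1`.
    have key := H.foldError_tail (N := N) (r := c ^ 2 * Real.log d) hδ hh hσ hsubG hmhat hC.le
      hq htail (t := c₁ * Real.sqrt (Real.log (N * d))) (by positivity) hε0 hlt.le
      (by positivity)
    have hthr := sqrt_le_mul_rateBound (σ := σ) hN hd (by linarith : 0 ≤ c)
      (by linarith : 0 ≤ c₁) (by linarith : 0 ≤ c₂) hδ (maxSecondMoment_nonneg (P := P) h) hv
    have hmono := (measureReal_mono (μ := (Measure.pi fun _ : Fin N => P.map observe).prod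
      (Measure.pi fun _ : Fin N => P.map observe))
      (fun D (hD : D ∈ F) => hD.imp fun j hj => hthr.trans_lt hj)).trans key
    refine hmono.trans ?_
    have e1 : (N : ℝ) * ε ^ 2 = c₂ ^ 2 * Real.log d := by
      rw [hε, mul_pow, Real.sq_sqrt (by positivity)]; field_simp
    have e2 : (c₁ * Real.sqrt (Real.log (N * d))) ^ 2 = c₁ ^ 2 * Real.log (N * d) := by
      rw [mul_pow, Real.sq_sqrt hl1]
    rw [e1, e2, hpow hd0, mul_assoc 2 (d : ℝ), hpow hd0]
    have h1 : N * Real.exp (-(c₁ ^ 2 * Real.log (N * d))) ≤ ((N : ℝ) * d) ^ (-(c₁ ^ 2 - 1)) := by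
      rw [← hpow hNd0]
      gcongr
      nlinarith
    have h2 : C * (N * Real.exp (-(c₁ ^ 2 * Real.log (N * d)))) ≤
        C * ((N : ℝ) * d) ^ (-(c₁ ^ 2 - 1)) := by gcongr
    have h3 : N * q ≤ q * (N * d) := by
      rw [mul_comm]; gcongr; nlinarith
    have h4 : 0 ≤ C * ((N : ℝ) * d) ^ (-(c₁ ^ 2 - 1)) := by positivity
    have h5 : 0 ≤ q * (N * d) := by positivity
    have h6 : 0 ≤ (d : ℝ) ^ (-(c₂ ^ 2 - 1)) := by positivity
    nlinarith
  refine (measureReal_mono fun ω hω => ?_).trans (hsample.real_le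
    (A := fun s => ⋃ k, (fun z => (subsample s k z, subsample s (Fin.rev k) z)) ⁻¹' F)
    (fun s => MeasurableSet.iUnion fun k =>
      (measurePreserving_subsample (P.map observe) s k).measurable hFm) (by positivity)
    fun s => ?_)
  · obtain ⟨k, j, hj⟩ := exists_foldError_lt hN hB0 hω
    exact Set.mem_iUnion.mpr ⟨k, j, hj⟩
  · refine (measureReal_iUnion_fintype_le _).trans ?_
    have : ∀ k, (Measure.pi fun _ => P.map observe).real
        ((fun z => (subsample s k z, subsample s (Fin.rev k) z)) ⁻¹' F) ≤ _ := fun k =>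
      ((measurePreserving_subsample (P.map observe) s k).measureReal_preimage
        hFm.nullMeasurableSet).trans_le hFb
    rw [Fin.sum_univ_two]
    linarith [this 0, this 1]

/-! ### Asymptotics -/

/-- The `σ + 1` supplies the strict Orlicz bound required by `integral_sq_le_of_orliczNorm`; only a
constant independent of `N` matters here. -/
lemma maxSecondMoment_le {p d : ℕ} {P : Measure (Triple p)} {h : (Fin p → ℝ) → Fin d → ℝ}
    (hh : Measurable h) {σ : ℝ} (hσ : 0 ≤ σ)
    (hsubG : orliczNormVec 2 (fun z => h (xCoord z)) P ≤ ENNReal.ofReal σ) :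
    maxSecondMoment P h ≤ (σ + 1) ^ 2 := by
  refine Real.iSup_le (fun j => ?_) (sq_nonneg _)
  have hx := measurable_xCoord (p := p)
  have hlt : orliczNorm 2 (fun z => h (xCoord z) j) P < ENNReal.ofReal (σ + 1) :=
    ((le_iSup (fun j => orliczNorm 2 (fun z => h (xCoord z) j) P) j).trans hsubG).trans_lt
      ((ENNReal.ofReal_lt_ofReal_iff (by linarith)).mpr (by linarith))
  exact integral_sq_le_of_orliczNorm (by fun_prop) hlt

lemma rateBound_le {c c₁ c₂ δ σ M v : ℝ} {N d : ℕ} (hd : 2 ≤ d) (hc : 0 ≤ c) (hc₁ : 0 ≤ c₁)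
    (hδ : 0 < δ) (hv : 0 ≤ v) (hM : M ≤ (σ + 1) ^ 2)
    (hlt : c₂ * Real.sqrt (Real.log d / N) ≤ 1) :
    rateBound c c₁ c₂ δ σ M v N d ≤
      (c * C1star c₁ δ * Real.sqrt ((σ + 1) ^ 2 + 6 * σ ^ 2)) *
        (Real.sqrt (Real.log d / (2 * N)) * (v * Real.sqrt (Real.log (2 * N * d)))) := by
  have hd2 : (2 : ℝ) ≤ d := by exact_mod_cast hd
  have hC := C1star_nonneg hc₁ hδ
  rw [rateBound, C2star_mul_sqrt]
  have h1 : M + 6 * (c₂ * Real.sqrt (Real.log d / N)) * σ ^ 2 ≤ (σ + 1) ^ 2 + 6 * σ ^ 2 := by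
    nlinarith [sq_nonneg σ]
  calc _ ≤ c * Real.sqrt (Real.log d / (2 * N)) * (v * Real.sqrt (Real.log (2 * N * d))) *
        C1star c₁ δ * Real.sqrt ((σ + 1) ^ 2 + 6 * σ ^ 2) := by gcongr
    _ = _ := by ring

/-- A constant that may be enlarged as long as it stays below `√(N / log d)` can be chosen so that
the associated tail probability is exponentially small in `N`. -/
lemma exists_enlarged_constant {c₂ : ℝ} {N d : ℕ} (hc₂ : 1 < c₂) (hN : 1 ≤ N) (hd : 2 ≤ d)
    (hlt : c₂ * Real.sqrt (Real.log d / N) < 1) :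
    ∃ b : ℝ, 1 < b ∧ b * Real.sqrt (Real.log d / N) < 1 ∧
      (d : ℝ) ^ (-(b ^ 2 - 1)) ≤ Real.exp (-((1 - 1 / c₂ ^ 2) / 4 * N)) := by
  have hN0 : (0 : ℝ) < N := by exact_mod_cast hN
  have hd2 : (2 : ℝ) ≤ d := by exact_mod_cast hd
  have hld : 0 < Real.log d := Real.log_pos (by linarith)
  set w := Real.sqrt (Real.log d / N) with hw
  have hw0 : 0 < w := Real.sqrt_pos.mpr (by positivity)
  have hw2 : N * w ^ 2 = Real.log d := by rw [hw, Real.sq_sqrt (by positivity)]; field_simp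
  -- The choice `1 / (2 w)` forces `b w ≥ 1/2`, hence `b² log d ≥ N / 4`, while `b ≥ c₂` gives `b² -
  -- 1 ≥ (1 - 1 / c₂²) b²`.
  refine ⟨max c₂ (1 / (2 * w)), hc₂.trans_le (le_max_left _ _), ?_, ?_⟩
  · rw [max_mul_of_nonneg _ _ hw0.le]
    refine max_lt hlt ?_
    rw [show 1 / (2 * w) * w = 1 / 2 by field_simp]
    norm_num
  · set b := max c₂ (1 / (2 * w)) with hb
    have hb1 : c₂ ≤ b := le_max_left _ _
    have hb2 : 1 / 2 ≤ b * w := by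
      have : 1 / (2 * w) * w ≤ b * w := by gcongr; exact le_max_right _ _
      rwa [show 1 / (2 * w) * w = 1 / 2 by field_simp] at this
    rw [Real.rpow_def_of_pos (by linarith)]
    refine Real.exp_le_exp.mpr ?_
    have h1 : b ^ 2 * (1 - 1 / c₂ ^ 2) ≤ b ^ 2 - 1 := by
      have : 1 ≤ b ^ 2 / c₂ ^ 2 := by rw [one_le_div (by positivity)]; gcongr
      calc _ = b ^ 2 - b ^ 2 / c₂ ^ 2 := by ring
        _ ≤ _ := by linarith
    have h2 : (N : ℝ) / 4 ≤ b ^ 2 * Real.log d := by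
      rw [← hw2]
      have : 1 / 4 ≤ (b * w) ^ 2 := by nlinarith
      nlinarith
    have h3 : 0 ≤ 1 - 1 / c₂ ^ 2 := by
      rw [sub_nonneg, div_le_one (by positivity)]; nlinarith
    have h4 := mul_le_mul_of_nonneg_left h2 h3
    have h5 := mul_le_mul_of_nonneg_right h1 hld.le
    nlinarith

/-- Base `2` is the worst case, since `d ≥ 2` and the exponent is negative. -/
lemma exists_const_rpow_le {η : ℝ} (hη : 0 < η) :
    ∃ c : ℝ, 1 < c ∧ (2 : ℝ) ^ (-(c ^ 2 - 1)) ≤ η := by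
  have h1 : Tendsto (fun c : ℝ => -(c ^ 2 - 1)) atTop atBot := by
    refine tendsto_neg_atTop_atBot.comp ?_
    exact tendsto_atTop_add_const_right _ _ (tendsto_pow_atTop two_ne_zero)
  have h2 := (tendsto_rpow_atBot_of_base_gt_one (2 : ℝ) one_lt_two).comp h1
  obtain ⟨c, hc1, hc2⟩ := ((eventually_gt_atTop (1 : ℝ)).and (h2.eventually_le_const hη)).exists
  exact ⟨c, hc1, hc2⟩

end CrossFit

/-! ### The theorem: finite-sample bound and asymptotic consequences. -/

theorem mainTheorem5
    -- constants that do not vary with the sample size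
    (δ σh C : ℝ) (hδ : 0 < δ) (hδ1 : δ ≤ 1) (hσh : 0 ≤ σh) (hC : 0 < C)
    -- everything below may vary with the fold size `N`; the sample size is `n = 2 * N`
    (p d : ℕ → ℕ) (hd : ∀ N, 2 ≤ d N)
    (v q : ℕ → ℝ) (hv : ∀ N, 0 ≤ v N) (hq : ∀ N, 0 ≤ q N ∧ q N ≤ 1)
    (P : ∀ N, Measure (CrossFit.Triple (p N))) [∀ N, IsProbabilityMeasure (P N)]
    (prop m : ∀ N, (Fin (p N) → ℝ) → ℝ)
    (hmodel : ∀ N, CrossFit.IsMissingDataModel (P N) (prop N) (m N) δ)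
    (h : ∀ N, (Fin (p N) → ℝ) → Fin (d N) → ℝ) (hh : ∀ N, Measurable (h N))
    (hsubG : ∀ N, CrossFit.orliczNormVec 2 (fun z => h N (CrossFit.xCoord z)) (P N)
      ≤ ENNReal.ofReal σh)
    (mhat : ∀ N, (Fin N → CrossFit.Triple (p N)) → (Fin (p N) → ℝ) → ℝ)
    (hmhat : ∀ N, Measurable (Function.uncurry (mhat N)))
    (htail : ∀ N, 1 ≤ N → CrossFit.HasPointwiseTail (P N) (m N) (mhat N) C (v N) (q N))
    (Ω : ℕ → Type*) [∀ N, MeasurableSpace (Ω N)]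
    (μ : ∀ N, Measure (Ω N)) [∀ N, IsProbabilityMeasure (μ N)]
    (Z : ∀ N, Fin (2 * N) → Ω N → CrossFit.Triple (p N))
    (S : ∀ N, Ω N → CrossFit.Split N)
    (hsample : ∀ N, CrossFit.IsSplitSample (μ N) (P N) (Z N) (S N)) :
    -- the finite-sample bound
    (∀ c c₁ c₂ : ℝ, 1 < c → 1 < c₁ → 1 < c₂ →
      ∀ N : ℕ, 1 ≤ N → c₂ * Real.sqrt (Real.log (d N) / N) < 1 →
        1 - 4 * (d N : ℝ) ^ (-(c ^ 2 - 1)) - 8 * (d N : ℝ) ^ (-(c₂ ^ 2 - 1))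
            - 4 * C * ((N : ℝ) * d N) ^ (-(c₁ ^ 2 - 1)) - 4 * q N * (N * d N)
          ≤ (μ N).real {ω |
              ‖CrossFit.errorTerm (prop N) (m N) (h N) (mhat N) (S N ω) (fun i => Z N i ω)‖
                ≤ CrossFit.rateBound c c₁ c₂ δ σh (CrossFit.maxSecondMoment (P N) (h N)) (v N)
                    N (d N)}) ∧
    CrossFit.barConst δ ≤ δ⁻¹ ∧
    -- the lower-order claim
    (Tendsto (fun N : ℕ => v N * Real.sqrt (Real.log (2 * N * d N))) atTop (𝓝 0) →
      Tendsto (fun N : ℕ => q N * (2 * N * d N)) atTop (𝓝 0) →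
      ∀ c c₁ c₂ : ℝ, 1 < c → 1 < c₁ → 1 < c₂ →
      (∀ᶠ N : ℕ in atTop, c₂ * Real.sqrt (Real.log (d N) / N) < 1) →
        ((fun N : ℕ => CrossFit.rateBound c c₁ c₂ δ σh (CrossFit.maxSecondMoment (P N) (h N))
            (v N) N (d N)) =O[atTop] fun N : ℕ =>
              Real.sqrt (Real.log (d N) / (2 * N)) * (v N * Real.sqrt (Real.log (2 * N * d N)))) ∧
        ((fun N : ℕ => CrossFit.rateBound c c₁ c₂ δ σh (CrossFit.maxSecondMoment (P N) (h N))
            (v N) N (d N)) =o[atTop] fun N : ℕ => Real.sqrt (Real.log (d N) / (2 * N))) ∧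
        (∀ ε : ℝ, 0 < ε → Tendsto (fun N : ℕ => (μ N).real {ω |
            ε * Real.sqrt (Real.log (d N) / (2 * N)) <
              ‖CrossFit.errorTerm (prop N) (m N) (h N) (mhat N) (S N ω) (fun i => Z N i ω)‖})
          atTop (𝓝 0))) := by
  refine ⟨fun c c₁ c₂ hc hc₁ hc₂ N hN hlt => ?_, CrossFit.barConst_le_inv hδ hδ1,
    fun hv0 hq0 c c₁ c₂ hc hc₁ hc₂ hlt => ?_⟩
  · have key := CrossFit.errorTerm_tail hδ hσh hC (hd N) hN (hv N) (hq N).1 (hmodel N) (hh N)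
      (hsubG N) (hmhat N) (htail N hN) (hsample N) hc hc₁ hc₂ hlt
    -- Subadditivity replaces the complement rule, so the event need not be shown measurable.
    have hcov : (1 : ℝ) ≤ (μ N).real {ω |
          ‖CrossFit.errorTerm (prop N) (m N) (h N) (mhat N) (S N ω) (fun i => Z N i ω)‖
            ≤ CrossFit.rateBound c c₁ c₂ δ σh (CrossFit.maxSecondMoment (P N) (h N)) (v N) N (d N)}
        + (μ N).real {ω |
          CrossFit.rateBound c c₁ c₂ δ σh (CrossFit.maxSecondMoment (P N) (h N)) (v N) N (d N) <
            ‖CrossFit.errorTerm (prop N) (m N) (h N) (mhat N) (S N ω) (fun i => Z N i ω)‖} := by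
      rw [← probReal_univ (μ := μ N)]
      refine (measureReal_mono fun ω _ => ?_).trans (measureReal_union_le _ _)
      exact le_or_gt ‖_‖ (_ : ℝ)
    linarith
  · have hM : ∀ N, CrossFit.maxSecondMoment (P N) (h N) ≤ (σh + 1) ^ 2 := fun N =>
      CrossFit.maxSecondMoment_le (hh N) hσh (hsubG N)
    have hO : (fun N : ℕ => CrossFit.rateBound c c₁ c₂ δ σh
        (CrossFit.maxSecondMoment (P N) (h N)) (v N) N (d N)) =O[atTop] fun N : ℕ =>
          Real.sqrt (Real.log (d N) / (2 * N)) * (v N * Real.sqrt (Real.log (2 * N * d N))) := by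
      refine IsBigO.of_bound
        (c * CrossFit.C1star c₁ δ * Real.sqrt ((σh + 1) ^ 2 + 6 * σh ^ 2)) ?_
      filter_upwards [hlt] with N hN
      rw [Real.norm_of_nonneg (CrossFit.rateBound_nonneg (by linarith) (by linarith) hδ (hv N)),
        Real.norm_of_nonneg (mul_nonneg (Real.sqrt_nonneg _)
          (mul_nonneg (hv N) (Real.sqrt_nonneg _)))]
      exact CrossFit.rateBound_le (hd N) (by linarith) (by linarith) hδ (hv N) (hM N) hN.le
    refine ⟨hO, hO.trans_isLittleO ?_, fun ε hε => ?_⟩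
    · have h1 := (isBigO_refl (fun N : ℕ => Real.sqrt (Real.log (d N) / (2 * N))) atTop).mul_isLittleO
        ((isLittleO_one_iff ℝ).mpr hv0)
      simpa using h1
    · have hN0 : Tendsto (fun N : ℕ => (N : ℝ)) atTop atTop := tendsto_natCast_atTop_atTop
      have hκ : 0 < (1 - 1 / c₂ ^ 2) / 4 := by
        have : 1 / c₂ ^ 2 < 1 := by rw [div_lt_one (by positivity)]; nlinarith
        linarith
      have ht1 : Tendsto (fun N : ℕ => 8 * Real.exp (-((1 - 1 / c₂ ^ 2) / 4 * N))) atTop (𝓝 0) := by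
        have := (Real.tendsto_exp_neg_atTop_nhds_zero.comp (hN0.const_mul_atTop hκ)).const_mul 8
        simpa using this
      have ht2 : Tendsto (fun N : ℕ => 4 * C * (N : ℝ) ^ (-(c₁ ^ 2 - 1))) atTop (𝓝 0) := by
        have := ((tendsto_rpow_neg_atTop (show 0 < c₁ ^ 2 - 1 by nlinarith)).comp hN0).const_mul
          (4 * C)
        simpa using this
      have ht3 : Tendsto (fun N : ℕ => 2 * (q N * (2 * N * d N))) atTop (𝓝 0) := by
        simpa using hq0.const_mul 2
      rw [Metric.tendsto_atTop']
      refine fun η hη => ?_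
      -- `b` plays the role of `c`. It depends on `η` but not on `N`, so it does not affect the
      -- order of the bound; `η / 16` makes the first of four error terms at most `η / 4`.
      obtain ⟨b, hb1, hb2⟩ := CrossFit.exists_const_rpow_le (show 0 < η / 16 by positivity)
      have ht4 : Tendsto (fun N : ℕ => (b * CrossFit.C1star c₁ δ *
          Real.sqrt ((σh + 1) ^ 2 + 6 * σh ^ 2)) *
            (v N * Real.sqrt (Real.log (2 * N * d N)))) atTop (𝓝 0) := by
        simpa using hv0.const_mul (b * CrossFit.C1star c₁ δ *
          Real.sqrt ((σh + 1) ^ 2 + 6 * σh ^ 2))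
      have hη4 : 0 < η / 4 := by positivity
      have hev := (((ht1.eventually_lt_const hη4).and (ht2.eventually_lt_const hη4)).and
        ((ht3.eventually_lt_const hη4).and (ht4.eventually_lt_const hε))).and
        (hlt.and (eventually_ge_atTop 1))
      obtain ⟨N₀, hN₀⟩ := eventually_atTop.mp hev
      refine ⟨N₀, fun N hNN => ?_⟩
      obtain ⟨⟨⟨hx1, hx2⟩, hx3, hx4⟩, hx5, hN⟩ := hN₀ N hNN.le
      rw [Real.dist_eq, sub_zero, abs_of_nonneg measureReal_nonneg]
      -- `a` replaces `c₂` and may vary with `N`: the rate bound depends on it only through `a √(log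
      -- d / N) < 1`.
      obtain ⟨a, ha1, ha2, ha3⟩ := CrossFit.exists_enlarged_constant hc₂ hN (hd N) hx5
      have key := CrossFit.errorTerm_tail hδ hσh hC (hd N) hN (hv N) (hq N).1 (hmodel N) (hh N)
        (hsubG N) (hmhat N) (htail N hN) (hsample N) hb1 hc₁ ha1 ha2
      have hrate : CrossFit.rateBound b c₁ a δ σh (CrossFit.maxSecondMoment (P N) (h N)) (v N) N
          (d N) ≤ ε * Real.sqrt (Real.log (d N) / (2 * N)) := by
        refine (CrossFit.rateBound_le (hd N) (by linarith) (by linarith) hδ (hv N) (hM N)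
          ha2.le).trans ?_
        rw [mul_left_comm, mul_comm ε]
        exact mul_le_mul_of_nonneg_left hx4.le (Real.sqrt_nonneg _)
      have hN1 : (1 : ℝ) ≤ N := by exact_mod_cast hN
      have hd2 : (2 : ℝ) ≤ d N := by exact_mod_cast hd N
      have h1 : (d N : ℝ) ^ (-(b ^ 2 - 1)) ≤ η / 16 :=
        (Real.rpow_le_rpow_of_nonpos two_pos hd2 (by nlinarith)).trans hb2
      have h2 : 4 * C * ((N : ℝ) * d N) ^ (-(c₁ ^ 2 - 1)) ≤ 4 * C * (N : ℝ) ^ (-(c₁ ^ 2 - 1)) :=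
        mul_le_mul_of_nonneg_left (Real.rpow_le_rpow_of_nonpos (by linarith)
          (by nlinarith) (by nlinarith)) (by positivity)
      calc _ ≤ _ := measureReal_mono fun ω hω => hrate.trans_lt hω
        _ ≤ _ := key
        _ < η := by linarith
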